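/- Let $y$ be a function analytic on a domain in $\mathbb{C}$ containing $z=\pm1$, with $y'(1)\neq 0$ and $y'(-1)\ne 0$. The Eynard–Orantin invariants of the curve $x=z+1/z$, $y=y(z)$ are the multidifferentials given by $\omega^0_1=y\,dx$, $\omega^0_2(z_1,z_2)=B(z_1,z_2)=\dfrac{dz_1\,dz_2}{(z_1-z_2)^2}$ and, for $2g-1+n>0$, $S=\{1,\dots,n\}$ and $\hat z=1/z$, $$\omega^g_{n+1}(z_0,z_S)=\sum_{\alpha=\pm1}\operatorname*{Res}_{z=\alpha}K(z_0,z)\Big[\omega^{g-1}_{n+2}(z,\hat z,z_S)+\sum_{\substack{g_1+g_2=g\\ I\sqcup J=S}}{}^{\!\!\!'}\ \omega^{g_1}_{|I|+1}(z,z_I)\,\omega^{g_2}_{|J|+1}(\hat z,z_J)\Big],\qquad K(z_0,z)=\frac{-\int_{\hat z}^{z}B(z_0,\cdot)}{2\,(y(z)-y(\hat z))\,dx(z)},$$ where the first term is absent if $g=0$, and the prime means that the terms with $(g_1,I)=(0,\emptyset)$ or $(g_2,J)=(0,\emptyset)$ are omitted. Let $g>1$. There is a unique function $N^g_1:\mathbb{Z}\to\mathbb{C}$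 that is given by one polynomial on the even integers and one polynomial on the odd integers and satisfies $$\omega^g_1(z)=\Big(\frac{d}{dz}\sum_{b>0}N^g_1(b)z^b\Big)dz$$ near $z=0$. It satisfies the following vanishing identities (the string equations for $n=0$ with right-hand side zero). (1) If $y(z)=z^m/m$ with $m\in\{1,2,\dots\}$, then $$N^g_1(m)=0,\qquad (m+1)N^g_1(m+1)+(m-1)N^g_1(m-1)=0,$$ $$(m-2)N^g_1(m-2)-2m\,N^g_1(m)+(m+2)N^g_1(m+2)=0.$$ (2) For every $y$ as above, $$\mathcal{D}\,y(\mathcal{D})\{mN^g_1(m)\}_{m=-1}=0,\qquad (1+\mathcal{D}^2)\,y(\mathcal{D})\{mN^g_1(m)\}_{m=-1}=0,\qquad (1-\mathcal{D}^2)^2\,y(\mathcal{D})\{mN^g_1(m)\}_{m=-2}=0.$$ Here $p(\mathcal{D})\{f(m)\}_{m=a}=\sum_i p_i f(a+i)$ for a polynomial $p(z)=\sum_i p_iz^i$, and $y(\mathcal{D})$ stands for $y^{(N)}(\mathcal{D})$ with any sufficiently large $N$, where $y^{(N)}(z)=\sum_{k=0}^N(a_k+zb_k)(1-z^2)^k$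 are the partial sums of the unique series of this form such that, for every $N$, $y^{(N)}$ agrees with $y$ at $z=\pm1$ in all derivatives of order at most $N$. -/

import Mathlib

open Polynomial Filter Topology

/-! ### Residues and the Eynard-Orantin recursion on the curve `x = z + 1/z`, `y = y(z)`

A (multi)differential `f(z₁,…,zₙ) dz₁⋯dzₙ` is represented by its coefficient function `f`. -/

/-- The residue of `f(z) dz` at `α`: the limit of `(2πi)⁻¹ ∮ f(z) dz` over the circles
`|z - α| = ε` as `ε → 0⁺`. -/
noncomputable def residueAt (f : ℂ → ℂ) (α : ℂ) : ℂ :=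
  limUnder (𝓝[>] (0 : ℝ))
    (fun ε : ℝ => (2 * (Real.pi : ℂ) * Complex.I)⁻¹ * ∮ z in C(α, ε), f z)

/-- The map `x(z) = z + 1/z`; its branch points are `z = 1` and `z = -1`, and the point
`ẑ ≠ z` with `x(ẑ) = x(z)` is `ẑ = 1/z`. -/
noncomputable def curveX (z : ℂ) : ℂ := z + 1 / z

/-- The coefficient of `dx(z) = (1 - 1/z²) dz`. -/
noncomputable def curveDX (z : ℂ) : ℂ := 1 - 1 / z ^ 2

theorem hasDerivAt_curveX {z : ℂ} (hz : z ≠ 0) : HasDerivAt curveX (curveDX z) z := by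
  have h := (hasDerivAt_id z).add (hasDerivAt_inv hz)
  have e : curveX = id + (fun y : ℂ => y⁻¹) := by
    funext w; simp [curveX]
  rw [e]
  have e2 : curveDX z = 1 + -(z ^ 2)⁻¹ := by rw [curveDX]; ring
  rw [e2]
  exact h

/-- The Bergmann kernel `B(w, z) = dw dz / (w - z)²` of the Riemann sphere. -/
noncomputable def bergmann (w z : ℂ) : ℂ := 1 / (w - z) ^ 2

/-- The integral `∫_p^q B(z₀, z')`, computed with the primitive `1 / (z₀ - z')`. -/
noncomputable def bergmannIntegral (z₀ p q : ℂ) : ℂ := 1 / (z₀ - q) - 1 / (z₀ - p)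

theorem hasDerivAt_bergmannIntegral {z₀ p q : ℂ} (h : z₀ ≠ q) :
    HasDerivAt (bergmannIntegral z₀ p) (bergmann z₀ q) q := by
  have h1 : z₀ - q ≠ 0 := sub_ne_zero.mpr h
  have h2 := ((hasDerivAt_id q).const_sub z₀).inv h1
  have h3 := h2.sub_const (1 / (z₀ - p))
  have e : bergmann z₀ q = -(-1) / (z₀ - q) ^ 2 := by rw [bergmann, neg_neg]
  rw [e]
  refine h3.congr_of_eventuallyEq (Eventually.of_forall fun w => ?_)
  simp [bergmannIntegral]

/-- The recursion kernel
`K(z₀, z) = - ∫_{ẑ}^{z} B(z₀, ·) / (2 (y(z) - y(ẑ)) dx(z))` with `ẑ = 1/z`. -/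
noncomputable def recursionKernel (y : ℂ → ℂ) (z₀ z : ℂ) : ℂ :=
  -bergmannIntegral z₀ (1 / z) z / (2 * (y z - y (1 / z)) * curveDX z)

/-- The sub-tuple `z_I` of `z_S`, in increasing order of the indices. -/
def subTuple {n : ℕ} (z : Fin n → ℂ) (I : Finset (Fin n)) : Fin I.card → ℂ :=
  fun i => z (I.orderEmbOfFin rfl i)

/-- The coefficient function of the Eynard-Orantin invariant `ω^g_n(z₁,…,zₙ)` of the curve
`x = z + 1/z`, `y = y(z)`: `ω^0_1 = y dx`, `ω^0_2 = B`, and for `2g - 2 + (n + 1) > 0`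
`ω^g_{n+1}(z₀, z_S) = ∑_{α = ±1} Res_{w = α} K(z₀, w) [ω^{g-1}_{n+2}(w, ŵ, z_S)
  + ∑ ω^{g₁}_{|I|+1}(w, z_I) ω^{g₂}_{|J|+1}(ŵ, z_J)]`,
the inner sum being over `g₁ + g₂ = g`, `I ⊔ J = S` without the terms that contain `ω^0_1`, that is,
those with `(g₁, I) = (0, ∅)` or `(g₂, J) = (0, ∅)`. The factor `-1/w²` is `dŵ/dw`.
For `n = 0` nothing is defined, and the value is `0` by convention. -/
noncomputable def eoForm (y : ℂ → ℂ) : (g n : ℕ) → (Fin n → ℂ) → ℂ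
  | _, 0, _ => 0
  | 0, 1, z => y (z 0) * curveDX (z 0)
  | 0, 2, z => bergmann (z 0) (z 1)
  | g, n + 1, z =>
      ∑ α ∈ ({1, -1} : Finset ℂ), residueAt (fun w =>
        recursionKernel y (z 0) w * (-(1 / w ^ 2)) *
          ((if h : 1 ≤ g then
              eoForm y (g - 1) (n + 2) (Fin.cons w (Fin.cons (1 / w) (Fin.tail z)))
            else 0) +
          ∑ g₁ : Fin (g + 1), ∑ I : Finset (Fin n),
            if h : (g₁.val = 0 ∧ I = ∅) ∨ (g - g₁.val = 0 ∧ Iᶜ = ∅) then 0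
            else
              eoForm y g₁.val (I.card + 1) (Fin.cons w (subTuple (Fin.tail z) I)) *
              eoForm y (g - g₁.val) (Iᶜ.card + 1)
                (Fin.cons (1 / w) (subTuple (Fin.tail z) Iᶜ)))) α
  termination_by g n => 2 * g + n
  decreasing_by
    · omega
    · have h1 : I.card + Iᶜ.card = n := by simp
      have h2 := g₁.isLt
      have h3 : ¬ (g - g₁.val = 0 ∧ Iᶜ.card = 0) := fun hh =>
        h (Or.inr ⟨hh.1, Finset.card_eq_zero.mp hh.2⟩)
      omega
    · have h1 : I.card + Iᶜ.card = n := by simp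
      have h2 := g₁.isLt
      have h3 : ¬ (g₁.val = 0 ∧ I.card = 0) := fun hh =>
        h (Or.inl ⟨hh.1, Finset.card_eq_zero.mp hh.2⟩)
      omega

/-! ### The quasi-polynomial `N^g_1` -/

/-- `N` is a quasi-polynomial depending on the parity of its argument. -/
def IsParityQuasiPolynomial (N : ℤ → ℂ) : Prop :=
  ∃ p₀ p₁ : ℂ[X], ∀ b : ℤ, N b = if Even b then p₀.eval (b : ℂ) else p₁.eval (b : ℂ)

/-- `N` is the quasi-polynomial `N^g_1` of the curve `x = z + 1/z`, `y = y(z)`: near `z = 0`,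
`ω^g_1(z) = (d/dz ∑_{b > 0} N(b) z^b) dz` (the index of the sum below is `b - 1`). -/
def IsEOQuasiPolynomial (y : ℂ → ℂ) (g : ℕ) (N : ℤ → ℂ) : Prop :=
  IsParityQuasiPolynomial N ∧
    ∀ᶠ z in 𝓝 (0 : ℂ),
      HasSum (fun k : ℕ => ((k : ℂ) + 1) * N ((k : ℤ) + 1) * z ^ k) (eoForm y g 1 (fun _ => z))

/-! ### The polynomials `y^{(N)}` and the operators `p(𝒟)`, `y(𝒟)` -/

/-- `∑_{k=0}^N (a_k + z b_k) (1 - z²)^k`. -/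
noncomputable def twoPointPoly (a b : ℕ → ℂ) (N : ℕ) : ℂ[X] :=
  ∑ k ∈ Finset.range (N + 1), (C (a k) + X * C (b k)) * (1 - X ^ 2) ^ k

/-- `y(z) ∼ ∑ (a_k + z b_k) (1 - z²)^k`: for every `N` the partial sum up to `k = N` agrees with `y`
at `z = ±1` up to the `N`th derivatives. -/
def IsTwoPointExpansion (y : ℂ → ℂ) (a b : ℕ → ℂ) : Prop :=
  ∀ N : ℕ, ∀ j ≤ N, ∀ α ∈ ({1, -1} : Finset ℂ),
    (derivative^[j] (twoPointPoly a b N)).eval α = iteratedDeriv j y α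

theorem eval_iterate_derivative_eq (p : ℂ[X]) (α : ℂ) (j : ℕ) :
    (derivative^[j] p).eval α = (j.factorial : ℂ) * (taylor α p).coeff j := by
  rw [taylor_coeff, ← factorial_smul_hasseDeriv]
  simp

theorem taylor_mul_one_sub_sq (q : ℂ[X]) (k : ℕ) {α : ℂ} (hα : α ^ 2 = 1) :
    taylor α (q * (1 - X ^ 2) ^ k) = taylor α q * (-(X + C (2 * α))) ^ k * X ^ k := by
  have h : taylor α ((1 : ℂ[X]) - X ^ 2) = -(X + C (2 * α)) * X := by
    have h1 : (1 : ℂ[X]) = C α ^ 2 := by rw [← C_pow, hα, C_1]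
    have h2 : (C (2 * α) : ℂ[X]) = 2 * C α := by rw [C_mul]; rfl
    rw [h2, h1]
    simp
    ring
  rw [taylor_mul, taylor_pow, h, mul_pow, mul_assoc]

theorem twoPoint_lower (q : ℂ[X]) {j k : ℕ} (hjk : j < k) {α : ℂ} (hα : α ^ 2 = 1) :
    (derivative^[j] (q * (1 - X ^ 2) ^ k)).eval α = 0 := by
  rw [eval_iterate_derivative_eq, taylor_mul_one_sub_sq q k hα, coeff_mul_X_pow']
  simp [not_le.mpr hjk]

theorem twoPoint_diag (q : ℂ[X]) (k : ℕ) {α : ℂ} (hα : α ^ 2 = 1) :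
    (derivative^[k] (q * (1 - X ^ 2) ^ k)).eval α
      = (k.factorial : ℂ) * (q.eval α * (-(2 * α)) ^ k) := by
  rw [eval_iterate_derivative_eq, taylor_mul_one_sub_sq q k hα, coeff_mul_X_pow']
  simp [coeff_zero_eq_eval_zero, taylor_eval]

theorem sq_eq_one_of_mem {α : ℂ} (h : α ∈ ({1, -1} : Finset ℂ)) : α ^ 2 = 1 := by
  simp only [Finset.mem_insert, Finset.mem_singleton] at h
  rcases h with rfl | rfl <;> norm_num

/-- Only the diagonal conditions `j = N` matter, since `(1 - z²)^k` vanishes to order `k`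
at `z = ±1`. -/
theorem isTwoPointExpansion_iff (y : ℂ → ℂ) (a b : ℕ → ℂ) :
    IsTwoPointExpansion y a b ↔ ∀ N : ℕ, ∀ α ∈ ({1, -1} : Finset ℂ),
      (derivative^[N] (twoPointPoly a b N)).eval α = iteratedDeriv N y α := by
  refine ⟨fun h N α hα => h N N le_rfl α hα, fun h N => ?_⟩
  induction N with
  | zero => intro j hj α hα; obtain rfl : j = 0 := by omega
            exact h 0 α hα
  | succ N ih =>
    intro j hj α hα
    rcases Nat.lt_or_ge j (N + 1) with hlt | hge
    · rw [twoPointPoly, Finset.sum_range_succ, iterate_map_add, eval_add,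
        twoPoint_lower _ hlt (sq_eq_one_of_mem hα), add_zero]
      exact ih j (by omega) α hα
    · obtain rfl : j = N + 1 := by omega
      exact h (N + 1) α hα

theorem twoPointPoly_diag (a b : ℕ → ℂ) (N : ℕ) {α : ℂ} (hα : α ^ 2 = 1) :
    (derivative^[N] (twoPointPoly a b N)).eval α
      = (derivative^[N] (∑ k ∈ Finset.range N,
          (C (a k) + X * C (b k)) * (1 - X ^ 2) ^ k)).eval α
        + (N.factorial : ℂ) * ((a N + α * b N) * (-(2 * α)) ^ N) := by
  rw [twoPointPoly, Finset.sum_range_succ, iterate_map_add, eval_add,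
    twoPoint_diag _ _ hα]
  simp only [eval_add, eval_mul, eval_C, eval_X]

/-- Every `y` has exactly one expansion `∑ (a_k + z b_k) (1 - z²)^k`. -/
theorem existsUnique_twoPointExpansion (y : ℂ → ℂ) :
    ∃! ab : (ℕ → ℂ) × (ℕ → ℂ), IsTwoPointExpansion y ab.1 ab.2 := by
  have hf : ∀ N : ℕ, (N.factorial : ℂ) ≠ 0 := fun N => by exact_mod_cast N.factorial_ne_zero
  have hp : ∀ (N : ℕ) {α : ℂ}, α ^ 2 = 1 → (-(2 * α)) ^ N ≠ 0 := fun N α hα => by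
    apply pow_ne_zero
    rintro h0
    have : α = 0 := by simpa using h0
    rw [this] at hα; norm_num at hα
  -- the coefficients, by recursion on the truncated sum
  let r : ℕ → ℂ[X] → ℂ → ℂ := fun N P α =>
    (iteratedDeriv N y α - (derivative^[N] P).eval α) / ((N.factorial : ℂ) * (-(2 * α)) ^ N)
  let A : ℕ → ℂ[X] → ℂ := fun N P => (r N P 1 + r N P (-1)) / 2
  let B : ℕ → ℂ[X] → ℂ := fun N P => (r N P 1 - r N P (-1)) / 2
  let T : ℕ → ℂ[X] := fun N => Nat.rec 0
    (fun k P => P + (C (A k P) + X * C (B k P)) * (1 - X ^ 2) ^ k) N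
  have hT : ∀ N, T N = ∑ k ∈ Finset.range N,
      (C (A k (T k)) + X * C (B k (T k))) * (1 - X ^ 2) ^ k := by
    intro N
    induction N with
    | zero => rfl
    | succ N ih =>
      rw [Finset.sum_range_succ, ← ih]
  refine ⟨(fun k => A k (T k), fun k => B k (T k)), ?_, ?_⟩
  · refine (isTwoPointExpansion_iff _ _ _).mpr ?_
    intro N α hα
    have hα2 := sq_eq_one_of_mem hα
    rw [twoPointPoly_diag _ _ _ hα2]
    have key : A N (T N) + α * B N (T N) = r N (T N) α := by
      simp only [Finset.mem_insert, Finset.mem_singleton] at hα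
      rcases hα with rfl | rfl <;> simp only [A, B] <;> ring
    dsimp only
    rw [key, ← hT N]
    simp only [r]
    field_simp [hf N, hp N hα2]
    ring
  · rintro ⟨a, b⟩ hab
    rw [isTwoPointExpansion_iff] at hab
    dsimp only at hab
    have main : ∀ N, a N = A N (T N) ∧ b N = B N (T N) := by
      intro N
      induction N using Nat.strong_induction_on with
      | _ N ih =>
        have hs : (∑ k ∈ Finset.range N, (C (a k) + X * C (b k)) * (1 - X ^ 2) ^ k) = T N := by
          rw [hT N]
          refine Finset.sum_congr rfl fun k hk => ?_
          rw [(ih k (Finset.mem_range.mp hk)).1, (ih k (Finset.mem_range.mp hk)).2]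
        have e : ∀ α ∈ ({1, -1} : Finset ℂ), a N + α * b N = r N (T N) α := by
          intro α hα
          have hα2 := sq_eq_one_of_mem hα
          have h := hab N α hα
          rw [twoPointPoly_diag _ _ _ hα2, hs] at h
          simp only [r]
          rw [eq_div_iff (mul_ne_zero (hf N) (hp N hα2)), ← h]
          ring
        have e1 := e 1 (by simp)
        have e2 := e (-1) (by simp)
        simp only [A, B, ← e1, ← e2]
        constructor <;> ring
    ext k
    · exact (main k).1
    · exact (main k).2

/-- The partial sum `y^{(N)}(z) = ∑_{k=0}^N (a_k + z b_k) (1 - z²)^k`, where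
`∑ (a_k + z b_k) (1 - z²)^k` is the expansion of `y`. -/
noncomputable def partialSum (y : ℂ → ℂ) (N : ℕ) : ℂ[X] :=
  twoPointPoly (existsUnique_twoPointExpansion y).choose.1
    (existsUnique_twoPointExpansion y).choose.2 N

theorem partialSum_spec (y : ℂ → ℂ) {N j : ℕ} (hj : j ≤ N) {α : ℂ}
    (hα : α ∈ ({1, -1} : Finset ℂ)) :
    (derivative^[j] (partialSum y N)).eval α = iteratedDeriv j y α :=
  (existsUnique_twoPointExpansion y).choose_spec.1 N j hj α hα

/-- `p(𝒟){f(n)}_{n=a} = ∑ p_i f(a + i)` for a polynomial `p(z) = ∑ p_i z^i`, where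
`𝒟 f(n) = f(n + 1)`. -/
noncomputable def shiftApply (p : ℂ[X]) (f : ℤ → ℂ) (a : ℤ) : ℂ :=
  p.sum fun i c => c * f (a + i)

/-- `p(𝒟) y(𝒟){f(n)}_{n=a} = v`, where `y(𝒟)` stands for `y^{(N)}(𝒟)` with any large enough `N`. -/
def ShiftValueEq (p : ℂ[X]) (y : ℂ → ℂ) (f : ℤ → ℂ) (a : ℤ) (v : ℂ) : Prop :=
  ∀ᶠ N : ℕ in atTop, shiftApply (p * partialSum y N) f a = v

/-! Write ŵ = 1/w, ŷ(w) = y(ŵ), and call a differential antisymmetric if w ↦ ŵ changes its sign.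

Structure. Every stable ω^g_{n+1} is, away from the branch points, a finite combination of products
of the forms (x - 2β)^{-j-1} dz/z with β = ±1; these are antisymmetric with poles only at ±1
(`isProductCombination_eoForm`, by induction on 2g + n). The kernel expands in a geometric series in
x(w) - 2α whose coefficients are such forms in z₀, and a residue sees only finitely many terms. The
one factor that is not antisymmetric is B; its symmetric part vanishes at α. After pairing the terms
exchanged by w ↦ ŵ, symmetric parts enter only through products of two of them, of order at least 2,
and the simple pole of the kernel cannot make these contribute.

Residues. For n = 0 and g > 1 the bracket is a quadratic differential q, a combination of products
of two antisymmetric forms. The recursion says that ω = ω^g_1 is the sum of the principal parts of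
-q / ((y - ŷ) dx) at ±1 (`exists_onePointForm`). In x^k y ω write y = (y + ŷ)/2 + (y - ŷ)/2. The
first half gives an antisymmetric differential, which has no residue. The second gives -x^k q / (2
dx), the pullback of a rational differential on the x-line with finite poles only at x = ±2 and, for
k ≤ 2, none at infinity. Hence the residues of x^k y ω at ±1 sum to zero
(`hasResidueSum_curveX_pow_mul_mul`).

Translation. For all integers b, b N(b) is the sum of the residues of z^b ω at ±1
(`poleSpace_exists_quasiPolynomial`), so p(𝒟) becomes multiplication by p, and the string equations
are the cases k = 0, 1, 2. A partial sum of high order may replace y, because it agrees with y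
beyond the pole orders of ω. -/

/-! ### Germs of meromorphic functions and their residues -/

/-- `f` is meromorphic at `α` with order at least `m`. -/
def HasOrdGE (α : ℂ) (m : ℤ) (f : ℂ → ℂ) : Prop :=
  ∃ φ : ℂ → ℂ, AnalyticAt ℂ φ α ∧ ∀ᶠ w in 𝓝[≠] α, f w = (w - α) ^ m * φ w

theorem AnalyticAt.hasOrdGE_zero {α : ℂ} {f : ℂ → ℂ} (hf : AnalyticAt ℂ f α) : HasOrdGE α 0 f :=
  ⟨f, hf, Eventually.of_forall fun w => by simp⟩

namespace HasOrdGE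

variable {α : ℂ} {m m' : ℤ} {f g : ℂ → ℂ}

theorem congr (hf : HasOrdGE α m f) (h : ∀ᶠ w in 𝓝[≠] α, g w = f w) : HasOrdGE α m g := by
  obtain ⟨φ, hφ, hfφ⟩ := hf
  exact ⟨φ, hφ, by filter_upwards [hfφ, h] with w h1 h2; rw [h2, h1]⟩

theorem mono (hf : HasOrdGE α m f) (h : m' ≤ m) : HasOrdGE α m' f := by
  obtain ⟨φ, hφ, hfφ⟩ := hf
  obtain ⟨d, hd⟩ := Int.le.dest h
  refine ⟨fun w => (w - α) ^ d * φ w, by fun_prop, ?_⟩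
  filter_upwards [hfφ, self_mem_nhdsWithin] with w h1 h2
  have h3 : w - α ≠ 0 := sub_ne_zero.mpr h2
  rw [h1, ← hd, zpow_add₀ h3, zpow_natCast, mul_assoc]

theorem zero : HasOrdGE α m 0 :=
  ⟨0, analyticAt_const, Eventually.of_forall fun w => by simp⟩

theorem add (hf : HasOrdGE α m f) (hg : HasOrdGE α m g) : HasOrdGE α m (fun w => f w + g w) := by
  obtain ⟨φ, hφ, hfφ⟩ := hf
  obtain ⟨ψ, hψ, hgψ⟩ := hg
  refine ⟨fun w => φ w + ψ w, by fun_prop, ?_⟩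
  filter_upwards [hfφ, hgψ] with w h1 h2
  rw [h1, h2, mul_add]

theorem mul (hf : HasOrdGE α m f) (hg : HasOrdGE α m' g) :
    HasOrdGE α (m + m') (fun w => f w * g w) := by
  obtain ⟨φ, hφ, hfφ⟩ := hf
  obtain ⟨ψ, hψ, hgψ⟩ := hg
  refine ⟨fun w => φ w * ψ w, by fun_prop, ?_⟩
  filter_upwards [hfφ, hgψ, self_mem_nhdsWithin] with w h1 h2 h3
  rw [h1, h2, zpow_add₀ (sub_ne_zero.mpr h3)]
  ring

theorem const_mul (c : ℂ) (hf : HasOrdGE α m f) : HasOrdGE α m (fun w => c * f w) := by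
  simpa using (analyticAt_const (v := c)).hasOrdGE_zero.mul hf

/-- An analytic germ that vanishes at `α` raises the order by one. -/
theorem succ_of_eq_zero {φ : ℂ → ℂ} (hφ : AnalyticAt ℂ φ α) (h0 : φ α = 0)
    (h : ∀ᶠ w in 𝓝[≠] α, f w = (w - α) ^ m * φ w) : HasOrdGE α (m + 1) f := by
  have h1 : ((1 : ℕ) : ℕ∞) ≤ analyticOrderAt φ α := by
    rw [natCast_le_analyticOrderAt_iff_iteratedDeriv_eq_zero hφ]
    intro i hi
    obtain rfl : i = 0 := by omega
    simpa using h0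
  obtain ⟨ψ, hψ, hφψ⟩ := (natCast_le_analyticOrderAt hφ).mp h1
  refine ⟨ψ, hψ, ?_⟩
  filter_upwards [h, hφψ.filter_mono nhdsWithin_le_nhds, self_mem_nhdsWithin] with w h1 h2 h3
  rw [h1, h2, zpow_add₀ (sub_ne_zero.mpr h3)]
  simp [mul_assoc]

/-- The reciprocal of a germ whose leading coefficient does not vanish. -/
theorem inv {φ : ℂ → ℂ} (hφ : AnalyticAt ℂ φ α) (h0 : φ α ≠ 0)
    (h : ∀ᶠ w in 𝓝[≠] α, f w = (w - α) ^ m * φ w) : HasOrdGE α (-m) (fun w => (f w)⁻¹) := by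
  refine ⟨fun w => (φ w)⁻¹, hφ.inv h0, ?_⟩
  filter_upwards [h] with w h1
  rw [h1, mul_inv, zpow_neg]

theorem inv_of_deriv_ne_zero (hf : AnalyticAt ℂ f α) (h0 : f α = 0) (h1 : deriv f α ≠ 0) :
    HasOrdGE α (-1) (fun w => (f w)⁻¹) := by
  have h2 : ((1 : ℕ) : ℕ∞) ≤ analyticOrderAt f α := by
    rw [natCast_le_analyticOrderAt_iff_iteratedDeriv_eq_zero hf]
    intro i hi
    obtain rfl : i = 0 := by omega
    simpa using h0
  obtain ⟨ψ, hψ, hfψ⟩ := (natCast_le_analyticOrderAt hf).mp h2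
  refine inv (m := 1) hψ ?_ ((hfψ.filter_mono nhdsWithin_le_nhds).mono
    fun w hw => by simpa using hw)
  have h3 : HasDerivAt (fun w => (w - α) ^ 1 • ψ w) (1 * ψ α + (α - α) * deriv ψ α) α := by
    have := ((hasDerivAt_id α).sub_const α).mul hψ.differentiableAt.hasDerivAt
    refine this.congr_of_eventuallyEq (Eventually.of_forall fun w => ?_)
    simp
  rw [EventuallyEq.deriv_eq hfψ, h3.deriv] at h1
  simpa using h1

theorem deriv (hf : HasOrdGE α m f) : HasOrdGE α (m - 1) (deriv f) := by
  obtain ⟨φ, hφ, h⟩ := hf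
  refine ⟨fun w => m * φ w + (w - α) * _root_.deriv φ w, by fun_prop, ?_⟩
  have h' := (eventually_eventually_nhdsWithin (a := α) (s := {α}ᶜ)).mpr h
  filter_upwards [h', self_mem_nhdsWithin,
    hφ.eventually_analyticAt.filter_mono nhdsWithin_le_nhds] with w h1 h2 h3
  have h4 : w - α ≠ 0 := sub_ne_zero.mpr h2
  have h5 : f =ᶠ[𝓝 w] fun w => (w - α) ^ m * φ w := by
    rwa [nhdsWithin_eq_nhds.mpr (isOpen_compl_singleton.mem_nhds h2)] at h1
  have h6 : HasDerivAt (fun w => (w - α) ^ m) (m * (w - α) ^ (m - 1)) w := by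
    simpa using (hasDerivAt_zpow m (w - α) (Or.inl h4)).comp_sub_const w α
  have h8 : HasDerivAt (fun w => (w - α) ^ m * φ w) _ w :=
    h6.mul h3.differentiableAt.hasDerivAt
  rw [h5.deriv_eq, h8.deriv]
  have h7 : (w - α) ^ m = (w - α) ^ (m - 1) * (w - α) := by
    rw [← zpow_add_one₀ h4, sub_add_cancel]
  rw [h7]
  ring

theorem of_iteratedDeriv_eq_zero (hf : AnalyticAt ℂ f α) {n : ℕ}
    (h : ∀ i < n, iteratedDeriv i f α = 0) : HasOrdGE α n f := by
  obtain ⟨ψ, hψ, hfψ⟩ := (natCast_le_analyticOrderAt hf).mp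
    ((natCast_le_analyticOrderAt_iff_iteratedDeriv_eq_zero hf).mpr h)
  exact ⟨ψ, hψ, (hfψ.filter_mono nhdsWithin_le_nhds).mono fun w hw => by simpa using hw⟩

end HasOrdGE

/-- `f` has the residue `r` at `α`: the integrals over all small circles are `2πi r`. -/
def HasResidue (f : ℂ → ℂ) (α r : ℂ) : Prop :=
  ∀ᶠ ε : ℝ in 𝓝[>] 0, CircleIntegrable f α ε ∧
    (2 * (Real.pi : ℂ) * Complex.I)⁻¹ * (∮ z in C(α, ε), f z) = r

theorem eventually_sphere_of_eventually_punctured {α : ℂ} {p : ℂ → Prop}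
    (h : ∀ᶠ w in 𝓝[≠] α, p w) : ∀ᶠ ε : ℝ in 𝓝[>] 0, ∀ w ∈ Metric.sphere α ε, p w := by
  obtain ⟨δ, hδ, H⟩ := Metric.mem_nhdsWithin_iff.mp h
  filter_upwards [Ioo_mem_nhdsGT hδ] with ε hε w hw
  refine H ⟨?_, ?_⟩
  · rw [Metric.mem_ball, Metric.mem_sphere.mp hw]
    exact hε.2
  · rintro rfl
    rw [Metric.mem_sphere, dist_self] at hw
    exact hε.1.ne hw

namespace HasResidue

variable {α r s : ℂ} {f g : ℂ → ℂ}

theorem residueAt_eq (h : HasResidue f α r) : residueAt f α = r :=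
  (tendsto_const_nhds.congr' (h.mono fun _ hε => hε.2.symm)).limUnder_eq

theorem unique (h : HasResidue f α r) (h' : HasResidue f α s) : r = s :=
  h.residueAt_eq.symm.trans h'.residueAt_eq

theorem congr (hf : HasResidue f α r) (h : ∀ᶠ w in 𝓝[≠] α, g w = f w) : HasResidue g α r := by
  filter_upwards [hf, eventually_sphere_of_eventually_punctured h, self_mem_nhdsWithin]
    with ε h1 h2 h3
  have h3' : (0 : ℝ) ≤ ε := le_of_lt h3
  refine ⟨(circleIntegrable_congr ?_).mpr h1.1, ?_⟩
  · rw [abs_of_nonneg h3']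
    exact h2
  · rw [← h1.2, circleIntegral.integral_congr h3' h2]

theorem add (hf : HasResidue f α r) (hg : HasResidue g α s) :
    HasResidue (fun w => f w + g w) α (r + s) := by
  filter_upwards [hf, hg] with ε h1 h2
  refine ⟨h1.1.add h2.1, ?_⟩
  rw [circleIntegral.integral_add h1.1 h2.1, mul_add, h1.2, h2.2]

theorem const_mul (c : ℂ) (hf : HasResidue f α r) : HasResidue (fun w => c * f w) α (c * r) := by
  filter_upwards [hf] with ε h1
  refine ⟨h1.1.const_fun_smul (a := c), ?_⟩
  rw [circleIntegral.integral_const_mul, ← h1.2]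
  ring

end HasResidue

/-- Cauchy's formula: the residue of `φ(w) / (w - α)^{n+1}` is the `n`th Taylor coefficient
of `φ`. -/
theorem AnalyticAt.hasResidue_zpow_mul {α : ℂ} {φ : ℂ → ℂ} (hφ : AnalyticAt ℂ φ α) (n : ℕ) :
    HasResidue (fun w => (w - α) ^ (-(n + 1 : ℤ)) * φ w) α (iteratedDeriv n φ α / n.factorial) := by
  obtain ⟨δ, hδ, H⟩ := Metric.eventually_nhds_iff_ball.mp hφ.eventually_analyticAt
  filter_upwards [Ioo_mem_nhdsGT hδ] with ε hε
  have hε0 : 0 < ε := hε.1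
  have hd : DifferentiableOn ℂ φ (Metric.closedBall α ε) := fun w hw =>
    (H w (Metric.closedBall_subset_ball hε.2 hw)).differentiableAt.differentiableWithinAt
  have h0 : ∀ w ∈ Metric.sphere α ε, w - α ≠ 0 := fun w hw h => by
    rw [sub_eq_zero.mp h, Metric.mem_sphere, dist_self] at hw
    exact hε0.ne hw
  constructor
  · refine ContinuousOn.circleIntegrable hε0.le (ContinuousOn.mul ?_
      (hd.continuousOn.mono Metric.sphere_subset_closedBall))
    exact ContinuousOn.zpow₀ (by fun_prop) _ fun w hw => Or.inl (h0 w hw)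
  · have h1 := DiffContOnCl.circleIntegral_one_div_sub_center_pow_smul hε0 n
      (f := φ) (c := α) (hd.diffContOnCl_ball subset_rfl)
    have h2 : (∮ z in C(α, ε), (z - α) ^ (-(n + 1 : ℤ)) * φ z)
        = ∮ z in C(α, ε), (1 / (z - α) ^ (n + 1)) • φ z := by
      refine circleIntegral.integral_congr hε0.le fun w _ => ?_
      simp only [smul_eq_mul, one_div, zpow_neg]
      norm_cast
    rw [h2, h1, smul_eq_mul]
    have := Complex.two_pi_I_ne_zero
    field_simp

theorem hasResidue_zero_of_hasOrdGE {α : ℂ} {f : ℂ → ℂ} (hf : HasOrdGE α 0 f) :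
    HasResidue f α 0 := by
  obtain ⟨φ, hφ, h⟩ := hf
  -- Cauchy's formula with a simple pole is applied to (w - α) φ, which vanishes at α.
  have h1 : AnalyticAt ℂ (fun w => (w - α) * φ w) α := by fun_prop
  have h2 := h1.hasResidue_zpow_mul 0
  simp only [iteratedDeriv_zero, sub_self, zero_mul, zero_div] at h2
  refine h2.congr ?_
  filter_upwards [h, self_mem_nhdsWithin] with w h3 h4
  have h5 : w - α ≠ 0 := sub_ne_zero.mpr h4
  rw [h3]
  norm_num
  field_simp

theorem HasOrdGE.exists_hasResidue {α : ℂ} {m : ℤ} {f : ℂ → ℂ} (hf : HasOrdGE α m f) :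
    ∃ r, HasResidue f α r := by
  obtain ⟨n, hn⟩ : ∃ n : ℕ, -(n + 1 : ℤ) ≤ m := ⟨m.natAbs, by omega⟩
  obtain ⟨φ, hφ, h⟩ := hf.mono hn
  exact ⟨_, (hφ.hasResidue_zpow_mul n).congr h⟩

theorem iteratedDeriv_polynomial_eval (P : ℂ[X]) (n : ℕ) :
    iteratedDeriv n (fun w => P.eval w) = fun w => (derivative^[n] P).eval w := by
  induction n with
  | zero => simp
  | succ n ih =>
    rw [iteratedDeriv_succ, ih]
    funext w
    rw [Polynomial.deriv, Function.iterate_succ_apply']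

/-- The residue of `P(w) / (w - α)^{n+1}` vanishes if `P` is a polynomial of degree less
than `n`. -/
theorem hasResidue_polynomial_of_natDegree_lt {α : ℂ} {P : ℂ[X]} {n : ℕ} (h : P.natDegree < n) :
    HasResidue (fun w => (w - α) ^ (-(n + 1 : ℤ)) * P.eval w) α 0 := by
  have h1 : AnalyticAt ℂ (fun w => P.eval w) α := P.differentiable.analyticAt α
  have h2 := h1.hasResidue_zpow_mul n
  have h3 : iteratedDeriv n (fun w => P.eval w) α = 0 := by
    rw [iteratedDeriv_polynomial_eval]
    simp [Polynomial.iterate_derivative_eq_zero h]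
  rwa [h3, zero_div] at h2

/-- An exact differential has no residue. -/
theorem hasResidue_zero_of_hasDerivAt {α : ℂ} {m : ℤ} {f F : ℂ → ℂ} (hf : HasOrdGE α m f)
    (h : ∀ᶠ w in 𝓝[≠] α, HasDerivAt F (f w) w) : HasResidue f α 0 := by
  obtain ⟨r, hr⟩ := hf.exists_hasResidue
  filter_upwards [hr, eventually_sphere_of_eventually_punctured h, self_mem_nhdsWithin]
    with ε h1 h2 h3
  refine ⟨h1.1, ?_⟩
  rw [circleIntegral.integral_eq_zero_of_hasDerivWithinAt (le_of_lt h3)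
    fun z hz => (h2 z hz).hasDerivWithinAt, mul_zero]

/-! ### Antisymmetric differentials with poles at `±1` -/

theorem ne_zero_of_sq_eq_one {α : ℂ} (hα : α ^ 2 = 1) : α ≠ 0 := by
  rintro rfl
  norm_num at hα

/-- Near a branch point `α = ±1`, punctured, a point `w` is neither `0` nor `1` nor `-1`. -/
theorem eventually_punctured_ne {α : ℂ} (hα : α ^ 2 = 1) :
    ∀ᶠ w in 𝓝[≠] α, w ≠ 0 ∧ w ^ 2 ≠ 1 := by
  have h0 := ne_zero_of_sq_eq_one hα
  have h1 : -α ≠ α := fun h => h0 (self_eq_neg.mp h.symm)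
  filter_upwards [self_mem_nhdsWithin,
    (isOpen_compl_singleton.mem_nhds h0.symm.symm : {(0 : ℂ)}ᶜ ∈ 𝓝 α) |> nhdsWithin_le_nhds,
    (isOpen_compl_singleton.mem_nhds h1.symm : {-α}ᶜ ∈ 𝓝 α) |> nhdsWithin_le_nhds]
    with w h2 h3 h4
  refine ⟨h3, fun h => ?_⟩
  rcases sq_eq_sq_iff_eq_or_eq_neg.mp (h.trans hα.symm) with h5 | h5
  · exact h2 h5
  · exact h4 h5

theorem tendsto_one_div_punctured {α : ℂ} (hα : α ^ 2 = 1) :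
    Tendsto (fun w : ℂ => 1 / w) (𝓝[≠] α) (𝓝[≠] α) := by
  have h0 := ne_zero_of_sq_eq_one hα
  have h1 : 1 / α = α := by field_simp; rw [hα]
  refine tendsto_nhdsWithin_iff.mpr ⟨?_, ?_⟩
  · have : ContinuousAt (fun w : ℂ => 1 / w) α := by fun_prop (disch := assumption)
    have h2 := this.tendsto
    simp only [h1] at h2
    exact h2.mono_left nhdsWithin_le_nhds
  · filter_upwards [self_mem_nhdsWithin] with w h2 h3
    rw [Set.mem_singleton_iff] at h3
    refine h2 ?_
    rw [Set.mem_singleton_iff, ← h1, ← h3, one_div_one_div]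

/-- The differential `z^j dz / (z - β)^{2j+2} = (x - 2β)^{-j-1} dz / z`. -/
noncomputable def poleForm (β : ℂ) (j : ℕ) (z : ℂ) : ℂ := z ^ j / (z - β) ^ (2 * j + 2)

/-- The function x - 2β is invariant under z ↦ 1/z and dz/z changes sign. The factor w² in place of
-1 comes from d(1/w) = -dw/w². -/
theorem poleForm_one_div {β : ℂ} (hβ : β ^ 2 = 1) (j : ℕ) {w : ℂ} (hw : w ≠ 0) :
    poleForm β j (1 / w) = w ^ 2 * poleForm β j w := by
  have h0 := ne_zero_of_sq_eq_one hβ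
  have h1 : (1 / w - β) ^ (2 * j + 2) = (w - β) ^ (2 * j + 2) / w ^ (2 * j + 2) := by
    have h2 : (1 / w - β) ^ 2 = (w - β) ^ 2 / w ^ 2 := by
      field_simp
      linear_combination (w ^ 2 - 1) * hβ
    rw [show 2 * j + 2 = 2 * (j + 1) by ring, pow_mul, h2, div_pow, ← pow_mul, ← pow_mul]
  rw [poleForm, poleForm, h1]
  rcases eq_or_ne w β with rfl | h3
  · simp
  · have h4 := sub_ne_zero.mpr h3
    rw [div_pow, one_pow]
    field_simp
    ring

/-- The space of the antisymmetric rational differentials whose poles are at `±1`. -/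
noncomputable def poleSpace : Submodule ℂ (ℂ → ℂ) :=
  Submodule.span ℂ {f | ∃ β : ℂ, β ^ 2 = 1 ∧ ∃ j : ℕ, f = poleForm β j}

theorem poleForm_mem {β : ℂ} (hβ : β ^ 2 = 1) (j : ℕ) : poleForm β j ∈ poleSpace :=
  Submodule.subset_span ⟨β, hβ, j, rfl⟩

theorem poleSpace_one_div {f : ℂ → ℂ} (hf : f ∈ poleSpace) {w : ℂ} (hw : w ≠ 0) :
    f (1 / w) = w ^ 2 * f w := by
  induction hf using Submodule.span_induction with
  | mem f h =>
    obtain ⟨β, hβ, j, rfl⟩ := h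
    exact poleForm_one_div hβ j hw
  | zero => simp
  | add f g _ _ hf hg => simp only [Pi.add_apply, hf, hg, mul_add]
  | smul c f _ hf => simp only [Pi.smul_apply, smul_eq_mul, hf]; ring

theorem poleForm_hasOrdGE (α : ℂ) (j : ℕ) : HasOrdGE α (-(2 * j + 2 : ℤ)) (poleForm α j) := by
  refine ⟨fun w => w ^ j, by fun_prop, Eventually.of_forall fun w => ?_⟩
  rw [poleForm, zpow_neg, div_eq_inv_mul]
  norm_cast

theorem poleForm_analyticAt {α β : ℂ} (h : α ≠ β) (j : ℕ) : AnalyticAt ℂ (poleForm β j) α := by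
  have h1 : (α - β) ^ (2 * j + 2) ≠ 0 := pow_ne_zero _ (sub_ne_zero.mpr h)
  unfold poleForm
  fun_prop (disch := assumption)

theorem poleSpace_hasOrdGE {f : ℂ → ℂ} (hf : f ∈ poleSpace) (α : ℂ) : ∃ m, HasOrdGE α m f := by
  induction hf using Submodule.span_induction with
  | mem f h =>
    obtain ⟨β, hβ, j, rfl⟩ := h
    rcases eq_or_ne α β with rfl | h
    · exact ⟨_, poleForm_hasOrdGE α j⟩
    · exact ⟨0, (poleForm_analyticAt h j).hasOrdGE_zero⟩
  | zero => exact ⟨0, HasOrdGE.zero⟩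
  | add f g _ _ hf hg =>
    obtain ⟨m, hm⟩ := hf
    obtain ⟨n, hn⟩ := hg
    exact ⟨min m n, (hm.mono (min_le_left _ _)).add (hn.mono (min_le_right _ _))⟩
  | smul c f _ hf =>
    obtain ⟨m, hm⟩ := hf
    exact ⟨m, hm.const_mul c⟩

/-! ### Antisymmetric germs -/

/-- The germ of differential `h(w) dw` at a branch point is antisymmetric under `w ↦ 1/w`. -/
def IsAntisymmAt (h : ℂ → ℂ) (α : ℂ) : Prop :=
  ∀ᶠ w in 𝓝[≠] α, h (1 / w) = w ^ 2 * h w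

/-- The residue is the Taylor coefficient of order 2j + 1 of the numerator z^j, whose degree is
smaller. -/
theorem hasResidue_poleForm (α : ℂ) (j : ℕ) : HasResidue (poleForm α j) α 0 := by
  have h := hasResidue_polynomial_of_natDegree_lt (α := α) (P := X ^ j) (n := 2 * j + 1)
    (by rw [natDegree_X_pow]; omega)
  refine h.congr (Eventually.of_forall fun w => ?_)
  rw [poleForm, zpow_neg, div_eq_inv_mul]
  simp only [eval_pow, eval_X]
  norm_cast

theorem IsAntisymmAt.sub {h h' : ℂ → ℂ} {α : ℂ} (hh : IsAntisymmAt h α)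
    (hh' : IsAntisymmAt h' α) : IsAntisymmAt (fun w => h w - h' w) α := by
  filter_upwards [hh, hh'] with w h1 h2
  rw [h1, h2, mul_sub]

/-- An antisymmetric germ has even pole order. -/
theorem IsAntisymmAt.hasOrdGE_of_odd {h : ℂ → ℂ} {α : ℂ} (hα : α ^ 2 = 1) (hh : IsAntisymmAt h α)
    {j : ℕ} (ho : HasOrdGE α (-(2 * j + 1 : ℤ)) h) : HasOrdGE α (-(2 * j : ℤ)) h := by
  have h0 := ne_zero_of_sq_eq_one hα
  have h1 : 1 / α = α := by field_simp; rw [hα]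
  obtain ⟨φ, hφ, he⟩ := ho
  have key : φ α = 0 := by
    -- Antisymmetry is rewritten for φ by means of 1/w - α = (w - α)/(-αw). In the limit w → α the
    -- odd exponent yields -φ(α) = φ(α).
    have e1 : (fun w => (-α * w) ^ (2 * j + 1) * φ (1 / w)) =ᶠ[𝓝[≠] α] fun w => w ^ 2 * φ w := by
      filter_upwards [he, (tendsto_one_div_punctured hα).eventually he, hh,
        eventually_punctured_ne hα, self_mem_nhdsWithin] with w e1 e2 e3 e4 e5
      have e6 : w - α ≠ 0 := sub_ne_zero.mpr e5
      have e7 : 1 / w - α = (w - α) / (-α * w) := by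
        have := e4.1
        field_simp
        linear_combination (-w) * hα
      have e8 : -α * w ≠ 0 := mul_ne_zero (neg_ne_zero.mpr h0) e4.1
      rw [e1, e2, e7, zpow_neg, zpow_neg] at e3
      have e9 : ((2 : ℤ) * j + 1) = ((2 * j + 1 : ℕ) : ℤ) := by push_cast; ring
      rw [e9, zpow_natCast, zpow_natCast, div_pow, inv_div] at e3
      have e10 := pow_ne_zero (2 * j + 1) e6
      field_simp at e3
      linear_combination e3
    have c1 : Tendsto (fun w => (-α * w) ^ (2 * j + 1) * φ (1 / w)) (𝓝[≠] α)
        (𝓝 ((-α * α) ^ (2 * j + 1) * φ α)) := by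
      refine Tendsto.mul ?_ ((hφ.continuousAt.tendsto.mono_left nhdsWithin_le_nhds).comp
        (tendsto_one_div_punctured hα))
      exact (by fun_prop : Continuous fun w : ℂ => (-α * w) ^ (2 * j + 1)).tendsto α
        |>.mono_left nhdsWithin_le_nhds
    have c2 : Tendsto (fun w => w ^ 2 * φ w) (𝓝[≠] α) (𝓝 (α ^ 2 * φ α)) :=
      (((continuous_pow 2).tendsto α).mul hφ.continuousAt.tendsto).mono_left nhdsWithin_le_nhds
    have c3 := tendsto_nhds_unique (c1.congr' e1) c2
    have c4 : -α * α = -1 := by linear_combination -hα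
    rw [c4, hα, Odd.neg_one_pow ⟨j, rfl⟩] at c3
    exact self_eq_neg.mp (by linear_combination -c3)
  have := HasOrdGE.succ_of_eq_zero hφ key he
  rwa [show -(2 * j + 1 : ℤ) + 1 = -(2 * j : ℤ) by ring] at this

/-- The principal part of an antisymmetric germ is a combination of the forms `poleForm α i`. -/
theorem IsAntisymmAt.exists_principalPart {α : ℂ} (hα : α ^ 2 = 1) (j : ℕ) :
    ∀ h : ℂ → ℂ, IsAntisymmAt h α → HasOrdGE α (-(2 * j : ℤ)) h →
      ∃ e : ℕ → ℂ, HasOrdGE α 0 (fun w => h w - ∑ i ∈ Finset.range j, e i * poleForm α i w) := by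
  have h0 := ne_zero_of_sq_eq_one hα
  induction j with
  | zero => intro h _ ho; exact ⟨0, by simpa using ho⟩
  | succ j ih =>
    intro h hh ho
    obtain ⟨φ, hφ, he⟩ := ho
    -- The leading coefficient of `poleForm α j` at α is α^j, so subtracting c times this form
    -- cancels the leading term of h. Parity then lowers the pole order by one more.
    set c := φ α / α ^ j with hc
    have a1 : IsAntisymmAt (fun w => h w - c * poleForm α j w) α := by
      refine hh.sub ?_
      filter_upwards [eventually_punctured_ne hα] with w hw
      rw [poleForm_one_div hα j hw.1]
      ring
    have a2 : HasOrdGE α (-(2 * j + 1 : ℤ)) (fun w => h w - c * poleForm α j w) := by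
      have := HasOrdGE.succ_of_eq_zero (α := α) (m := -(2 * ((j + 1 : ℕ) : ℤ)))
        (f := fun w => h w - c * poleForm α j w) (φ := fun w => φ w - c * w ^ j)
        (by fun_prop) (by rw [hc]; field_simp; ring) ?_
      · rwa [show -(2 * ((j + 1 : ℕ) : ℤ)) + 1 = -(2 * j + 1 : ℤ) by push_cast; ring] at this
      · filter_upwards [he] with w hw
        rw [hw, poleForm, mul_sub, zpow_neg,
          show 2 * ((j + 1 : ℕ) : ℤ) = ((2 * j + 2 : ℕ) : ℤ) by push_cast; ring, zpow_natCast,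
          div_eq_mul_inv]
        ring
    obtain ⟨e, h3⟩ := ih _ a1 (a1.hasOrdGE_of_odd hα a2)
    refine ⟨fun i => if i = j then c else e i, h3.congr (Eventually.of_forall fun w => ?_)⟩
    rw [Finset.sum_range_succ]
    have : ∑ i ∈ Finset.range j, (if i = j then c else e i) * poleForm α i w
        = ∑ i ∈ Finset.range j, e i * poleForm α i w := by
      refine Finset.sum_congr rfl fun i hi => ?_
      rw [if_neg (Finset.mem_range.mp hi).ne]
    rw [this]
    simp
    ring

theorem HasResidue.sum {α : ℂ} {ι : Type*} {s : Finset ι} {f : ι → ℂ → ℂ} {r : ι → ℂ}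
    (h : ∀ i ∈ s, HasResidue (f i) α (r i)) :
    HasResidue (fun w => ∑ i ∈ s, f i w) α (∑ i ∈ s, r i) := by
  classical
  induction s using Finset.induction_on with
  | empty =>
    exact (hasResidue_zero_of_hasOrdGE HasOrdGE.zero).congr (Eventually.of_forall fun w => by simp)
  | insert i s hi ih =>
    simp only [Finset.sum_insert hi]
    exact (h i (by simp)).add (ih fun j hj => h j (by simp [hj]))

theorem IsAntisymmAt.exists_sum {α : ℂ} (hα : α ^ 2 = 1) {h : ℂ → ℂ} (hh : IsAntisymmAt h α)
    {m : ℤ} (ho : HasOrdGE α m h) : ∃ (j : ℕ) (e : ℕ → ℂ),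
      HasOrdGE α 0 (fun w => h w - ∑ i ∈ Finset.range j, e i * poleForm α i w) :=
  ⟨m.natAbs, hh.exists_principalPart hα m.natAbs h (ho.mono (by omega))⟩

/-- The principal part is a combination of the forms `poleForm α i`, none of which has a residue. -/
theorem IsAntisymmAt.hasResidue_zero {α : ℂ} (hα : α ^ 2 = 1) {h : ℂ → ℂ}
    (hh : IsAntisymmAt h α) {m : ℤ} (ho : HasOrdGE α m h) : HasResidue h α 0 := by
  obtain ⟨j, e, he⟩ := hh.exists_sum hα ho
  have h1 := (hasResidue_zero_of_hasOrdGE he).add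
    (HasResidue.sum (s := Finset.range j) fun i _ => (hasResidue_poleForm α i).const_mul (e i))
  simp only [mul_zero, Finset.sum_const_zero, add_zero] at h1
  exact h1.congr (Eventually.of_forall fun w => by ring)

/-! ### The expansion of the recursion kernel at a branch point -/

/-- The local coordinate `x - 2α` at `x = 2α`, pulled back to the `z`-plane. -/
noncomputable def branchCoord (α w : ℂ) : ℂ := (w - α) ^ 2 / w

/-- Since (z - w)(z - 1/w) = z (x(z) - x(w)), the integral equals (w - 1/w) / (z (x(z) - x(w))).
With x(z) - 2α = (z - α)²/z this is a geometric series in `branchCoord α w` = x(w) - 2α, written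
with its exact remainder so that no convergence is involved. -/
theorem bergmannIntegral_expansion {α : ℂ} (hα : α ^ 2 = 1) {z w : ℂ} (hz : z ≠ α) (hw : w ≠ 0)
    (h1 : z ≠ w) (h2 : z ≠ 1 / w) (M : ℕ) :
    bergmannIntegral z (1 / w) w
      = ∑ j ∈ Finset.range M, (w - 1 / w) * branchCoord α w ^ j * poleForm α j z
        + branchCoord α w ^ M * (z ^ M / (z - α) ^ (2 * M)) * bergmannIntegral z (1 / w) w := by
  have a1 := sub_ne_zero.mpr h1
  have a2 := sub_ne_zero.mpr h2
  have a3 := sub_ne_zero.mpr hz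
  have key : bergmannIntegral z (1 / w) w * (z - α) ^ 2
      = (w - 1 / w) + branchCoord α w * z * bergmannIntegral z (1 / w) w := by
    have a4 : z * w - 1 ≠ 0 := by
      intro h
      apply h2
      field_simp
      linear_combination h
    have a5 : z - 1 / w = (z * w - 1) / w := by field_simp
    rw [bergmannIntegral, branchCoord, a5]
    field_simp
    linear_combination (w ^ 3 - w - z * w ^ 2 + z) * hα
  induction M with
  | zero => simp
  | succ M ih =>
    rw [Finset.sum_range_succ]
    nth_rewrite 1 [ih]
    rw [add_assoc]
    congr 1
    have a6 : bergmannIntegral z (1 / w) w = ((w - 1 / w)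
        + branchCoord α w * z * bergmannIntegral z (1 / w) w) / (z - α) ^ 2 := by
      rw [eq_div_iff (pow_ne_zero 2 a3), key]
    nth_rewrite 1 [a6]
    rw [poleForm]
    generalize bergmannIntegral z (1 / w) w = B
    generalize branchCoord α w = t
    generalize w - 1 / w = u
    field_simp
    ring

theorem bergmannIntegral_analyticAt {α z : ℂ} (hα : α ^ 2 = 1) (hz : z ≠ α) :
    AnalyticAt ℂ (fun w => bergmannIntegral z (1 / w) w) α := by
  have h0 := ne_zero_of_sq_eq_one hα
  have h1 : 1 / α = α := by field_simp; rw [hα]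
  have h2 := sub_ne_zero.mpr hz
  have h3 : z - 1 / α ≠ 0 := by rwa [h1]
  unfold bergmannIntegral
  fun_prop (disch := assumption)

theorem bergmannIntegral_hasOrdGE {α z : ℂ} (hα : α ^ 2 = 1) (hz : z ≠ α) :
    HasOrdGE α 1 (fun w => bergmannIntegral z (1 / w) w) := by
  have h0 := ne_zero_of_sq_eq_one hα
  have h1 : 1 / α = α := by field_simp; rw [hα]
  have := HasOrdGE.succ_of_eq_zero (m := 0) (bergmannIntegral_analyticAt hα hz)
    (by simp only [h1, bergmannIntegral, sub_self]) (Eventually.of_forall fun w => by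
      rw [zpow_zero, one_mul])
  simpa using this

theorem eventually_ne_of_ne {α z : ℂ} (hα : α ^ 2 = 1) (hz : z ≠ α) :
    ∀ᶠ w in 𝓝[≠] α, z ≠ w ∧ z ≠ 1 / w := by
  have h1 : ∀ᶠ w in 𝓝[≠] α, z ≠ w :=
    nhdsWithin_le_nhds ((isOpen_compl_singleton.mem_nhds hz.symm : {z}ᶜ ∈ 𝓝 α)
      |> mem_of_superset <| fun w hw => Ne.symm hw)
  exact h1.and ((tendsto_one_div_punctured hα).eventually h1)

theorem branchCoord_pow_hasOrdGE {α : ℂ} (h0 : α ≠ 0) (M : ℕ) :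
    HasOrdGE α (2 * M) (fun w => branchCoord α w ^ M) := by
  refine ⟨fun w => 1 / w ^ M, ?_, Eventually.of_forall fun w => ?_⟩
  · have : α ^ M ≠ 0 := pow_ne_zero _ h0
    fun_prop (disch := assumption)
  · simp only [branchCoord]
    rw [div_pow, ← pow_mul]
    norm_cast
    ring

/-- The kernel `(1/(z - w) - 1/(z - 1/w)) / 2` reproduces the forms `poleForm α i`. -/
theorem hasResidue_bergmannIntegral_mul_poleForm {α z : ℂ} (hα : α ^ 2 = 1) (hz : z ≠ α) (i : ℕ) :
    HasResidue (fun w => bergmannIntegral z (1 / w) w * poleForm α i w) α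
      (2 * poleForm α i z) := by
  have h0 := ne_zero_of_sq_eq_one hα
  -- With t = x(w) - 2α, the form `poleForm α i` is t^{-i-1} dw/w and (w - 1/w) dw/w = dt, so the
  -- j-th term is t^{j-i-1} dt. Only j = i has a residue; it is 2 because t has a double zero at α.
  have T : ∀ j ∈ Finset.range (i + 1),
      HasResidue (fun w => poleForm α j z * ((w - 1 / w) * branchCoord α w ^ j * poleForm α i w))
        α (poleForm α j z * if j = i then 2 else 0) := by
    intro j hj
    refine HasResidue.const_mul _ ?_
    obtain ⟨d, rfl⟩ : ∃ d, i = j + d := ⟨i - j, by have := Finset.mem_range.mp hj; omega⟩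
    rcases d with _ | d
    · have a1 : AnalyticAt ℂ (fun w => (w + α) / w) α := by fun_prop (disch := assumption)
      have a2 := a1.hasResidue_zpow_mul 0
      have a3 : iteratedDeriv 0 (fun w => (w + α) / w) α / (Nat.factorial 0 : ℂ) = 2 := by
        simp
        field_simp
        norm_num
      rw [a3] at a2
      rw [if_pos (by simp)]
      refine a2.congr ?_
      filter_upwards [eventually_punctured_ne hα, self_mem_nhdsWithin] with w hw hw2
      have b1 := hw.1
      have b2 : w - α ≠ 0 := sub_ne_zero.mpr hw2
      simp only [branchCoord, poleForm, add_zero, div_pow, ← pow_mul]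
      norm_num
      field_simp
      linear_combination (w - α) ^ (2 * j) * (w - α) * hα
    · rw [if_neg (by omega)]
      have a2 := hasResidue_polynomial_of_natDegree_lt (α := α) (P := (X + C α) * X ^ d)
        (n := 2 * (d + 1)) (lt_of_le_of_lt (natDegree_mul_le.trans (add_le_add
          (natDegree_X_add_C α).le (natDegree_X_pow_le d))) (by omega))
      refine a2.congr ?_
      filter_upwards [eventually_punctured_ne hα, self_mem_nhdsWithin] with w hw hw2
      have b1 := hw.1
      have b2 : w - α ≠ 0 := sub_ne_zero.mpr hw2
      simp only [branchCoord, poleForm, div_pow, ← pow_mul, eval_mul, eval_add, eval_X, eval_C,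
        eval_pow, zpow_neg]
      have b3 : (((2 * (d + 1) : ℕ) : ℤ) + 1) = ((2 * d + 3 : ℕ) : ℤ) := by push_cast; ring
      rw [b3, zpow_natCast]
      have b4 : w - 1 / w = (w - α) * (w + α) / w := by
        field_simp
        linear_combination hα
      rw [b4]
      field_simp
      ring
  -- The zero of order 2(i + 1) of the remainder cancels the pole of `poleForm α i`.
  have T2 : HasOrdGE α 0 (fun w => (z ^ (i + 1) / (z - α) ^ (2 * (i + 1))) *
      (branchCoord α w ^ (i + 1) * bergmannIntegral z (1 / w) w * poleForm α i w)) := by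
    refine HasOrdGE.const_mul _ ((((branchCoord_pow_hasOrdGE h0 (i + 1)).mul
      (bergmannIntegral_analyticAt hα hz).hasOrdGE_zero).mul (poleForm_hasOrdGE α i)).mono ?_)
    push_cast
    omega
  have h := (HasResidue.sum T).add (hasResidue_zero_of_hasOrdGE T2)
  have h' : ∑ j ∈ Finset.range (i + 1), poleForm α j z * (if j = i then 2 else 0) + 0
      = 2 * poleForm α i z := by
    simp [mul_comm]
  rw [h'] at h
  refine h.congr ?_
  filter_upwards [eventually_punctured_ne hα, eventually_ne_of_ne hα hz] with w hw hw2
  nth_rewrite 1 [bergmannIntegral_expansion hα hz hw.1 hw2.1 hw2.2 (i + 1)]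
  rw [add_mul, Finset.sum_mul]
  congr 1
  · exact Finset.sum_congr rfl fun j _ => by ring
  · ring

/-! ### Functions of several variables that are products of antisymmetric forms -/

section Expansions

/-- No coordinate of `z` is a branch point. -/
def AvoidsBranchPoints {ι : Type*} (z : ι → ℂ) : Prop := ∀ i, z i ^ 2 ≠ 1

/-- The span of the functions `∏_{i ∈ I} f_i(z_i)` with `f_i` in `poleSpace`. -/
noncomputable def productSpace {ι : Type*} (I : Finset ι) : Submodule ℂ ((ι → ℂ) → ℂ) :=
  Submodule.span ℂ {P | ∃ f : ι → ℂ → ℂ, (∀ i ∈ I, f i ∈ poleSpace) ∧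
    P = fun z => ∏ i ∈ I, f i (z i)}

theorem productSpace_mul {ι : Type*} [DecidableEq ι] {I J : Finset ι} (h : Disjoint I J) :
    productSpace I * productSpace J ≤ productSpace (I ∪ J) := by
  unfold productSpace
  rw [Submodule.span_mul_span, Submodule.span_le]
  rintro _ ⟨_, ⟨f, hf, rfl⟩, _, ⟨g, hg, rfl⟩, rfl⟩
  refine Submodule.subset_span ⟨fun i => if i ∈ I then f i else g i, fun i hi => ?_, ?_⟩
  · dsimp only
    split_ifs with h1
    · exact hf i h1
    · exact hg i ((Finset.mem_union.mp hi).resolve_left h1)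
  · funext z
    simp only [Pi.mul_apply]
    rw [Finset.prod_union h]
    congr 1
    · exact Finset.prod_congr rfl fun i hi => by rw [if_pos hi]
    · exact Finset.prod_congr rfl fun i hi => by rw [if_neg (Finset.disjoint_right.mp h hi)]

theorem productSpace_comp {ι κ : Type*} (σ : κ ↪ ι) {K : Finset κ} {P : (κ → ℂ) → ℂ}
    (hP : P ∈ productSpace K) : (fun z : ι → ℂ => P (z ∘ σ)) ∈ productSpace (K.map σ) := by
  induction hP using Submodule.span_induction with
  | mem P h =>
    obtain ⟨f, hf, rfl⟩ := h
    refine Submodule.subset_span ⟨Function.extend σ f 0, fun i hi => ?_, ?_⟩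
    · obtain ⟨k, hk, rfl⟩ := Finset.mem_map.mp hi
      rw [σ.injective.extend_apply]
      exact hf k hk
    · funext z
      rw [Finset.prod_map]
      exact Finset.prod_congr rfl fun k _ => by rw [σ.injective.extend_apply]; rfl
  | zero => exact Submodule.zero_mem _
  | add P Q _ _ hP hQ => exact Submodule.add_mem _ hP hQ
  | smul c P _ hP => exact Submodule.smul_mem _ c hP

theorem one_mem_productSpace_empty {ι : Type*} :
    (fun _ => 1) ∈ productSpace (∅ : Finset ι) :=
  Submodule.subset_span ⟨0, by simp, by simp⟩

theorem poleSpace_comp_apply_mem {ι : Type*} {f : ℂ → ℂ} (hf : f ∈ poleSpace) (i : ι) :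
    (fun z : ι → ℂ => f (z i)) ∈ productSpace {i} :=
  Submodule.subset_span ⟨fun _ => f, fun _ _ => hf, by simp⟩

/-- The span of the functions `c(w) P(z)` with `c` of order at least `k` at `α` and `P` in `U`. -/
noncomputable def separatedSpace {ι : Type*} (α : ℂ) (k : ℤ) (U : Submodule ℂ ((ι → ℂ) → ℂ)) :
    Submodule ℂ (ℂ → (ι → ℂ) → ℂ) :=
  Submodule.span ℂ {s | ∃ (c : ℂ → ℂ) (P : (ι → ℂ) → ℂ), HasOrdGE α k c ∧ P ∈ U ∧
    s = fun w z => c w * P z}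

variable {ι : Type*} {α : ℂ} {k l : ℤ} {U U' : Submodule ℂ ((ι → ℂ) → ℂ)}
  {s s' f f' : ℂ → (ι → ℂ) → ℂ}

theorem mul_mem_separatedSpace {c : ℂ → ℂ} {P : (ι → ℂ) → ℂ} (hc : HasOrdGE α k c) (hP : P ∈ U) :
    (fun w z => c w * P z) ∈ separatedSpace α k U :=
  Submodule.subset_span ⟨c, P, hc, hP, rfl⟩

theorem separatedSpace_mono (hk : l ≤ k) (hU : U ≤ U') :
    separatedSpace α k U ≤ separatedSpace α l U' := by
  refine Submodule.span_mono ?_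
  rintro _ ⟨c, P, hc, hP, rfl⟩
  exact ⟨c, P, hc.mono hk, hU hP, rfl⟩

theorem separatedSpace_mul :
    separatedSpace α k U * separatedSpace α l U' ≤ separatedSpace α (k + l) (U * U') := by
  conv_lhs => unfold separatedSpace
  rw [Submodule.span_mul_span, Submodule.span_le]
  rintro _ ⟨_, ⟨c, P, hc, hP, rfl⟩, _, ⟨d, Q, hd, hQ, rfl⟩, rfl⟩
  refine Submodule.subset_span ⟨_, P * Q, hc.mul hd, Submodule.mul_mem_mul hP hQ, ?_⟩
  funext w z
  simp only [Pi.mul_apply]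
  ring

theorem separatedSpace_hasOrdGE (hs : s ∈ separatedSpace α k U) (z : ι → ℂ) :
    HasOrdGE α k (fun w => s w z) := by
  induction hs using Submodule.span_induction with
  | mem s h =>
    obtain ⟨c, P, hc, _, rfl⟩ := h
    simpa [mul_comm] using hc.const_mul (P z)
  | zero => exact HasOrdGE.zero
  | add s t _ _ hs ht => exact hs.add ht
  | smul a s _ hs => exact hs.const_mul a

/-- On a product c(w) P(z) the residue acts on c alone, so the dependence on z stays in U. This
replaces any argument about residues depending analytically on parameters. -/
theorem separatedSpace_hasResidue (hs : s ∈ separatedSpace α k U) :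
    ∃ F ∈ U, ∀ z, HasResidue (fun w => s w z) α (F z) := by
  induction hs using Submodule.span_induction with
  | mem s h =>
    obtain ⟨c, P, hc, hP, rfl⟩ := h
    obtain ⟨r, hr⟩ := hc.exists_hasResidue
    refine ⟨r • P, Submodule.smul_mem _ _ hP, fun z => ?_⟩
    simpa [mul_comm] using hr.const_mul (P z)
  | zero => exact ⟨0, Submodule.zero_mem _, fun z => hasResidue_zero_of_hasOrdGE HasOrdGE.zero⟩
  | add s t _ _ hs ht =>
    obtain ⟨F, hF, h1⟩ := hs
    obtain ⟨G, hG, h2⟩ := ht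
    exact ⟨F + G, Submodule.add_mem _ hF hG, fun z => (h1 z).add (h2 z)⟩
  | smul a s _ hs =>
    obtain ⟨F, hF, h1⟩ := hs
    exact ⟨a • F, Submodule.smul_mem _ a hF, fun z => (h1 z).const_mul a⟩

/-- `f(w, z)` is, to every order in `w - α`, a finite sum of products `c(w) P(z)` with `P` in `U`
and with bounded pole orders of the coefficients `c`. -/
def IsExpandable (α : ℂ) (U : Submodule ℂ ((ι → ℂ) → ℂ)) (f : ℂ → (ι → ℂ) → ℂ) : Prop :=
  ∃ k : ℤ, ∀ M : ℤ, ∃ s ∈ separatedSpace α k U, ∀ z, AvoidsBranchPoints z →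
    HasOrdGE α M (fun w => f w z - s w z)

/-- `f(w, z)` is expandable up to terms of order at least `M`. -/
def IsExpandableMod (α : ℂ) (M : ℤ) (U : Submodule ℂ ((ι → ℂ) → ℂ))
    (f : ℂ → (ι → ℂ) → ℂ) : Prop :=
  ∃ E, IsExpandable α U E ∧ ∀ z, AvoidsBranchPoints z → HasOrdGE α M (fun w => f w z - E w z)

namespace IsExpandable

theorem of_mem (hs : s ∈ separatedSpace α k U) : IsExpandable α U s :=
  ⟨k, fun _ => ⟨s, hs, fun z _ => HasOrdGE.zero.congr (Eventually.of_forall fun w => by simp)⟩⟩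

theorem zero : IsExpandable α U 0 := of_mem (k := 0) (Submodule.zero_mem _)

theorem mono (hf : IsExpandable α U f) (hU : U ≤ U') : IsExpandable α U' f := by
  obtain ⟨k, hk⟩ := hf
  refine ⟨k, fun M => ?_⟩
  obtain ⟨s, hs, h⟩ := hk M
  exact ⟨s, separatedSpace_mono le_rfl hU hs, h⟩

theorem congr (hf : IsExpandable α U f)
    (h : ∀ z, AvoidsBranchPoints z → ∀ᶠ w in 𝓝[≠] α, f' w z = f w z) : IsExpandable α U f' := by
  obtain ⟨k, hk⟩ := hf
  refine ⟨k, fun M => ?_⟩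
  obtain ⟨s, hs, h'⟩ := hk M
  exact ⟨s, hs, fun z hz => (h' z hz).congr ((h z hz).mono fun w hw => by rw [hw])⟩

theorem hasOrdGE (hf : IsExpandable α U f) :
    ∃ k, ∀ z, AvoidsBranchPoints z → HasOrdGE α k (fun w => f w z) := by
  obtain ⟨k, hk⟩ := hf
  obtain ⟨s, hs, h⟩ := hk k
  exact ⟨k, fun z hz => ((h z hz).add (separatedSpace_hasOrdGE hs z)).congr
    (Eventually.of_forall fun w => by ring)⟩

theorem add (hf : IsExpandable α U f) (hf' : IsExpandable α U f') : IsExpandable α U (f + f') := by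
  obtain ⟨k, hk⟩ := hf
  obtain ⟨l, hl⟩ := hf'
  refine ⟨min k l, fun M => ?_⟩
  obtain ⟨s, hs, h⟩ := hk M
  obtain ⟨t, ht, h'⟩ := hl M
  exact ⟨s + t, Submodule.add_mem _ (separatedSpace_mono (min_le_left _ _) le_rfl hs)
    (separatedSpace_mono (min_le_right _ _) le_rfl ht), fun z hz => ((h z hz).add (h' z hz)).congr
      (Eventually.of_forall fun w => by simp only [Pi.add_apply]; ring)⟩

theorem mul (hf : IsExpandable α U f) (hf' : IsExpandable α U' f') :
    IsExpandable α (U * U') (f * f') := by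
  obtain ⟨m, hm⟩ := hf.hasOrdGE
  obtain ⟨n, hn⟩ := hf'.hasOrdGE
  obtain ⟨k, hk⟩ := hf
  obtain ⟨l, hl⟩ := hf'
  refine ⟨k + l, fun M => ?_⟩
  -- The error splits as f f' - s t = (f - s) f' + s (f' - t). The truncation orders compensate for
  -- the poles of f' and of s.
  obtain ⟨s, hs, h⟩ := hk (M - n)
  obtain ⟨t, ht, h'⟩ := hl (M - k)
  refine ⟨s * t, separatedSpace_mul (Submodule.mul_mem_mul hs ht), fun z hz => ?_⟩
  have h1 := ((h z hz).mul (hn z hz)).mono (show M ≤ _ by omega)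
  have h2 := ((separatedSpace_hasOrdGE hs z).mul (h' z hz)).mono (show M ≤ _ by omega)
  refine (h1.add h2).congr (Eventually.of_forall fun w => ?_)
  simp only [Pi.mul_apply]
  ring

theorem smul (a : ℂ) (hf : IsExpandable α U f) : IsExpandable α U (a • f) := by
  obtain ⟨k, hk⟩ := hf
  refine ⟨k, fun M => ?_⟩
  obtain ⟨s, hs, h⟩ := hk M
  exact ⟨a • s, Submodule.smul_mem _ a hs, fun z hz => ((h z hz).const_mul a).congr
    (Eventually.of_forall fun w => by simp only [Pi.smul_apply, smul_eq_mul]; ring)⟩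

theorem comp {κ : Type*} (σ : κ ↪ ι) {K : Finset κ} {f : ℂ → (κ → ℂ) → ℂ}
    (hf : IsExpandable α (productSpace K) f) :
    IsExpandable α (productSpace (K.map σ)) (fun w z => f w (z ∘ σ)) := by
  obtain ⟨k, hk⟩ := hf
  refine ⟨k, fun M => ?_⟩
  obtain ⟨s, hs, h⟩ := hk M
  refine ⟨fun w z => s w (z ∘ σ), ?_, fun z hz => h (z ∘ σ) fun i => hz (σ i)⟩
  clear h
  induction hs using Submodule.span_induction with
  | mem s h =>
    obtain ⟨c, P, hc, hP, rfl⟩ := h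
    exact mul_mem_separatedSpace hc (productSpace_comp σ hP)
  | zero => exact Submodule.zero_mem _
  | add s t _ _ hs ht => exact Submodule.add_mem _ hs ht
  | smul a s _ hs => exact Submodule.smul_mem _ a hs

/-- A function of `w` alone. -/
theorem of_hasOrdGE {c : ℂ → ℂ} (hc : HasOrdGE α k c) :
    IsExpandable α (productSpace (∅ : Finset ι)) (fun w _ => c w) := by
  have := mul_mem_separatedSpace hc (one_mem_productSpace_empty (ι := ι))
  simp only [mul_one] at this
  exact of_mem this

end IsExpandable

namespace IsExpandableMod

variable {M : ℤ}

theorem of_isExpandable (hf : IsExpandable α U f) : IsExpandableMod α M U f :=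
  ⟨f, hf, fun z _ => HasOrdGE.zero.congr (Eventually.of_forall fun w => by simp)⟩

theorem add (hf : IsExpandableMod α M U f) (hf' : IsExpandableMod α M U f') :
    IsExpandableMod α M U (f + f') := by
  obtain ⟨E, hE, h⟩ := hf
  obtain ⟨E', hE', h'⟩ := hf'
  exact ⟨E + E', hE.add hE', fun z hz => ((h z hz).add (h' z hz)).congr
    (Eventually.of_forall fun w => by simp only [Pi.add_apply]; ring)⟩

theorem smul (a : ℂ) (hf : IsExpandableMod α M U f) : IsExpandableMod α M U (a • f) := by
  obtain ⟨E, hE, h⟩ := hf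
  exact ⟨a • E, hE.smul a, fun z hz => ((h z hz).const_mul a).congr
    (Eventually.of_forall fun w => by simp only [Pi.smul_apply, smul_eq_mul]; ring)⟩

theorem sum {κ : Type*} {S : Finset κ} {f : κ → ℂ → (ι → ℂ) → ℂ}
    (h : ∀ i ∈ S, IsExpandableMod α M U (f i)) : IsExpandableMod α M U (∑ i ∈ S, f i) := by
  classical
  induction S using Finset.induction_on with
  | empty => simpa using of_isExpandable (M := M) (IsExpandable.zero (α := α) (U := U))
  | insert i S hi ih =>
    rw [Finset.sum_insert hi]
    exact (h i (by simp)).add (ih fun j hj => h j (by simp [hj]))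

theorem congr (hf : IsExpandableMod α M U f)
    (h : ∀ z, AvoidsBranchPoints z → ∀ᶠ w in 𝓝[≠] α, f' w z = f w z) :
    IsExpandableMod α M U f' := by
  obtain ⟨E, hE, h'⟩ := hf
  exact ⟨E, hE, fun z hz => (h' z hz).congr ((h z hz).mono fun w hw => by rw [hw])⟩

theorem comp {κ : Type*} (σ : κ ↪ ι) {K : Finset κ} {f : ℂ → (κ → ℂ) → ℂ}
    (hf : IsExpandableMod α M (productSpace K) f) :
    IsExpandableMod α M (productSpace (K.map σ)) (fun w z => f w (z ∘ σ)) := by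
  obtain ⟨E, hE, h⟩ := hf
  exact ⟨_, hE.comp σ, fun z hz => h (z ∘ σ) fun i => hz (σ i)⟩

theorem mul {n : ℤ} (hf : IsExpandable α U f)
    (hn : ∀ z, AvoidsBranchPoints z → HasOrdGE α n (fun w => f w z))
    (hf' : IsExpandableMod α M U' f') : IsExpandableMod α (n + M) (U * U') (f * f') := by
  obtain ⟨E, hE, h⟩ := hf'
  exact ⟨f * E, hf.mul hE, fun z hz => ((hn z hz).mul (h z hz)).congr
    (Eventually.of_forall fun w => by simp only [Pi.mul_apply]; ring)⟩

/-- Terms of nonnegative order have no residue, so a truncation at order 0 already determines it. -/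
theorem hasResidue (hf : IsExpandableMod α M U f) (hM : 0 ≤ M) :
    ∃ F ∈ U, ∀ z, AvoidsBranchPoints z → HasResidue (fun w => f w z) α (F z) := by
  obtain ⟨E, ⟨k, hk⟩, h⟩ := hf
  obtain ⟨s, hs, h'⟩ := hk 0
  obtain ⟨F, hF, h''⟩ := separatedSpace_hasResidue hs
  refine ⟨F, hF, fun z hz => ?_⟩
  have h1 := hasResidue_zero_of_hasOrdGE (((h z hz).mono hM).add (h' z hz))
  have h2 := h1.add (h'' z)
  rw [zero_add] at h2
  exact h2.congr (Eventually.of_forall fun w => by ring)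

end IsExpandableMod

theorem AvoidsBranchPoints.ne {z : ι → ℂ} (hz : AvoidsBranchPoints z) (hα : α ^ 2 = 1) (i : ι) :
    z i ≠ α := fun h => hz i (h ▸ hα)

theorem isExpandable_bergmannIntegral (hα : α ^ 2 = 1) (i : ι) :
    IsExpandable α (productSpace {i}) (fun w z => bergmannIntegral (z i) (1 / w) w) := by
  have h0 := ne_zero_of_sq_eq_one hα
  refine ⟨0, fun M => ⟨∑ j ∈ Finset.range M.toNat,
    fun w z => ((w - 1 / w) * branchCoord α w ^ j) * poleForm α j (z i),
    Submodule.sum_mem _ fun j _ => mul_mem_separatedSpace ?_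
      (poleSpace_comp_apply_mem (poleForm_mem hα j) i), fun z hz => ?_⟩⟩
  · have h1 : AnalyticAt ℂ (fun w => w - 1 / w) α := by fun_prop (disch := assumption)
    exact (h1.hasOrdGE_zero.mul (branchCoord_pow_hasOrdGE h0 j)).mono (by omega)
  · have hzα := hz.ne hα i
    have h1 := ((branchCoord_pow_hasOrdGE h0 M.toNat).mul
      (bergmannIntegral_analyticAt hα hzα).hasOrdGE_zero).const_mul
        (z i ^ M.toNat / (z i - α) ^ (2 * M.toNat))
    refine (h1.mono (show M ≤ _ by omega)).congr ?_
    filter_upwards [eventually_punctured_ne hα, eventually_ne_of_ne hα hzα] with w hw hw2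
    nth_rewrite 1 [bergmannIntegral_expansion hα hzα hw.1 hw2.1 hw2.2 M.toNat]
    simp only [Finset.sum_apply]
    ring

/-- Twice the antisymmetric part of B(·, z) is therefore exact, and its expansion is the derivative
of that of the kernel integral. -/
theorem hasDerivAt_bergmannIntegral_one_div {z w : ℂ} (hw : w ≠ 0) (h1 : z ≠ w) (h2 : z ≠ 1 / w) :
    HasDerivAt (fun w => bergmannIntegral z (1 / w) w)
      (bergmann w z + 1 / w ^ 2 * bergmann (1 / w) z) w := by
  have a1 := sub_ne_zero.mpr h1
  have a2 := sub_ne_zero.mpr h2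
  have a3 := sub_ne_zero.mpr h1.symm
  have a4 := sub_ne_zero.mpr h2.symm
  have d1 := (((hasDerivAt_id w).const_sub z).inv a1).sub
    (((hasDerivAt_inv hw).const_sub z).inv (by simpa using a2))
  refine (d1.congr_deriv ?_).congr_of_eventuallyEq (Eventually.of_forall fun u => ?_)
  · have e1 : (z - w) ^ 2 = (w - z) ^ 2 := by ring
    have e2 : (z - w⁻¹) ^ 2 = (w⁻¹ - z) ^ 2 := by ring
    simp only [id_eq]
    rw [e1, e2]
    simp only [bergmann, one_div, neg_neg]
    ring
  · simp [bergmannIntegral]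

/-- The antisymmetric part of the Bergmann kernel. -/
theorem isExpandable_bergmann (hα : α ^ 2 = 1) (i : ι) :
    IsExpandable α (productSpace {i})
      (fun w z => bergmann w (z i) + 1 / w ^ 2 * bergmann (1 / w) (z i)) := by
  have h0 := ne_zero_of_sq_eq_one hα
  have ha : ∀ (j : ℕ) (w : ℂ), w ≠ 0 →
      AnalyticAt ℂ (fun w => (w - 1 / w) * branchCoord α w ^ j) w := fun j w hw => by
    unfold branchCoord
    fun_prop (disch := assumption)
  -- The primitive is expanded to order M + 1, since differentiation costs one order.
  refine ⟨-1, fun M => ⟨∑ j ∈ Finset.range (M + 1).toNat,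
    fun w z => (deriv (fun w => (w - 1 / w) * branchCoord α w ^ j) w) * poleForm α j (z i),
    Submodule.sum_mem _ fun j _ => mul_mem_separatedSpace
      ((ha j α h0).hasOrdGE_zero.deriv.mono (by omega))
      (poleSpace_comp_apply_mem (poleForm_mem hα j) i), fun z hz => ?_⟩⟩
  have hzα := hz.ne hα i
  set n := (M + 1).toNat with hn
  set R : ℂ → ℂ := fun w => (z i ^ n / (z i - α) ^ (2 * n)) *
    (branchCoord α w ^ n * bergmannIntegral (z i) (1 / w) w) with hR
  have hRo : HasOrdGE α (M + 1) R :=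
    (((branchCoord_pow_hasOrdGE h0 n).mul
      (bergmannIntegral_analyticAt hα hzα).hasOrdGE_zero).const_mul _).mono (by omega)
  have hev : ∀ᶠ w in 𝓝[≠] α, R w = bergmannIntegral (z i) (1 / w) w
      - ∑ j ∈ Finset.range n, (w - 1 / w) * branchCoord α w ^ j * poleForm α j (z i) := by
    filter_upwards [eventually_punctured_ne hα, eventually_ne_of_ne hα hzα] with w hw hw2
    nth_rewrite 1 [bergmannIntegral_expansion hα hzα hw.1 hw2.1 hw2.2 n]
    rw [hR]
    ring
  refine (hRo.deriv.mono (show M ≤ _ by omega)).congr ?_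
  filter_upwards [eventually_punctured_ne hα, eventually_ne_of_ne hα hzα, self_mem_nhdsWithin,
    (eventually_eventually_nhdsWithin (a := α) (s := {α}ᶜ)).mpr hev] with w hw hw2 hw3 hw4
  -- At a point w ≠ α the identity holds on a full neighbourhood of w and can be differentiated.
  rw [nhdsWithin_eq_nhds.mpr (isOpen_compl_singleton.mem_nhds hw3)] at hw4
  have d1 := (hasDerivAt_bergmannIntegral_one_div hw.1 hw2.1 hw2.2).sub
    (HasDerivAt.fun_sum (u := Finset.range n) fun j _ =>
      ((ha j w hw.1).differentiableAt.hasDerivAt.mul_const (poleForm α j (z i))))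
  have d2 := d1.congr_of_eventuallyEq hw4
  rw [d2.deriv]
  simp only [Finset.sum_apply]

/-- The symmetric part of the Bergmann kernel vanishes at the branch points. -/
theorem hasOrdGE_bergmann_sub {z : ℂ} (hα : α ^ 2 = 1) (hz : z ≠ α) :
    HasOrdGE α 1 (fun w => bergmann w z - 1 / w ^ 2 * bergmann (1 / w) z) := by
  have h0 := ne_zero_of_sq_eq_one hα
  have h1 : 1 / α = α := by field_simp; rw [hα]
  have h2 := pow_ne_zero 2 (sub_ne_zero.mpr hz.symm)
  have h3 : (1 / α - z) ^ 2 ≠ 0 := by rwa [h1]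
  have h4 : α ^ 2 ≠ 0 := pow_ne_zero 2 h0
  have ha : AnalyticAt ℂ (fun w => bergmann w z - 1 / w ^ 2 * bergmann (1 / w) z) α := by
    unfold bergmann
    fun_prop (disch := assumption)
  have := HasOrdGE.succ_of_eq_zero (m := 0) ha (by simp only [h1, hα]; simp)
    (Eventually.of_forall fun w => by rw [zpow_zero, one_mul])
  simpa using this

end Expansions

/-! ### The Eynard-Orantin invariants are combinations of products of antisymmetric forms -/

section Structure

/-- `y` is analytic with nonzero derivative at the branch points. -/
def IsRegularAtBranchPoints (y : ℂ → ℂ) : Prop :=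
  ∀ α : ℂ, α ^ 2 = 1 → AnalyticAt ℂ y α ∧ deriv y α ≠ 0

/-- The part of the recursion kernel that does not depend on `z₀`. -/
noncomputable def kernelDenom (y : ℂ → ℂ) (w : ℂ) : ℂ :=
  ((y w - y (1 / w)) * curveDX w)⁻¹

theorem recursionKernel_eq (y : ℂ → ℂ) (z w : ℂ) :
    recursionKernel y z w = -(1 / 2) * kernelDenom y w * bergmannIntegral z (1 / w) w := by
  rw [recursionKernel, kernelDenom, mul_assoc, div_eq_mul_inv, mul_inv]
  ring

theorem one_div_of_sq_eq_one {α : ℂ} (hα : α ^ 2 = 1) : 1 / α = α := by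
  have h0 := ne_zero_of_sq_eq_one hα
  field_simp
  rw [hα]

theorem analyticAt_comp_one_div {y : ℂ → ℂ} {α : ℂ} (hα : α ^ 2 = 1) (hy : AnalyticAt ℂ y α) :
    AnalyticAt ℂ (fun w => y (1 / w)) α := by
  have h0 := ne_zero_of_sq_eq_one hα
  have h1 : AnalyticAt ℂ (fun w : ℂ => 1 / w) α := by fun_prop (disch := assumption)
  exact AnalyticAt.comp (g := y) (by rwa [one_div_of_sq_eq_one hα]) h1

theorem hasDerivAt_sub_comp_one_div {y : ℂ → ℂ} {α : ℂ} (hα : α ^ 2 = 1)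
    (hy : AnalyticAt ℂ y α) : HasDerivAt (fun w => y w - y (1 / w)) (2 * deriv y α) α := by
  have h0 := ne_zero_of_sq_eq_one hα
  have d1 : HasDerivAt y (deriv y α) (1 / α) := by
    rw [one_div_of_sq_eq_one hα]
    exact hy.differentiableAt.hasDerivAt
  have d2 : HasDerivAt (fun w : ℂ => 1 / w) (-(α ^ 2)⁻¹) α := by
    simpa using hasDerivAt_inv h0
  refine (hy.differentiableAt.hasDerivAt.sub (d1.comp α d2)).congr_deriv ?_
  rw [hα]
  norm_num
  ring

/-- Both y(w) - y(1/w) and dx have simple zeros at a branch point, with derivatives 2y'(α) and 2α.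
-/
theorem kernelDenom_hasOrdGE {y : ℂ → ℂ} (hy : IsRegularAtBranchPoints y) {α : ℂ}
    (hα : α ^ 2 = 1) : HasOrdGE α (-2) (kernelDenom y) := by
  have h0 := ne_zero_of_sq_eq_one hα
  have h1 := one_div_of_sq_eq_one hα
  obtain ⟨hya, hyd⟩ := hy α hα
  have A1 : HasOrdGE α (-1) (fun w => (y w - y (1 / w))⁻¹) := by
    refine HasOrdGE.inv_of_deriv_ne_zero (hya.fun_sub (analyticAt_comp_one_div hα hya))
      (by simp only [h1, sub_self]) ?_
    rw [(hasDerivAt_sub_comp_one_div hα hya).deriv]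
    exact mul_ne_zero two_ne_zero hyd
  have A2 : HasOrdGE α (-1) (fun w => (curveDX w)⁻¹) := by
    have h4 : α ^ 2 ≠ 0 := pow_ne_zero 2 h0
    refine HasOrdGE.inv_of_deriv_ne_zero (f := curveDX) ?_ (by simp [curveDX, hα]) ?_
    · unfold curveDX
      fun_prop (disch := assumption)
    · have d2 : HasDerivAt curveDX (2 * α) α := by
        have := ((hasDerivAt_pow 2 α).inv h4).const_sub 1
        refine (this.congr_deriv ?_).congr_of_eventuallyEq
          (Eventually.of_forall fun u => by simp [curveDX])
        rw [hα]
        norm_num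
      rw [d2.deriv]
      simpa using h0
  refine (A1.mul A2).congr (Eventually.of_forall fun w => ?_)
  rw [kernelDenom, mul_inv]

/-- The expression in brackets in the Eynard-Orantin recursion. -/
noncomputable def eoBracket (y : ℂ → ℂ) (g n : ℕ) (w : ℂ) (z : Fin n → ℂ) : ℂ :=
  (if _h : 1 ≤ g then eoForm y (g - 1) (n + 2) (Fin.cons w (Fin.cons (1 / w) z)) else 0) +
    ∑ g₁ : Fin (g + 1), ∑ I : Finset (Fin n),
      if _h : (g₁.val = 0 ∧ I = ∅) ∨ (g - g₁.val = 0 ∧ Iᶜ = ∅) then 0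
      else
        eoForm y g₁.val (I.card + 1) (Fin.cons w (subTuple z I)) *
        eoForm y (g - g₁.val) (Iᶜ.card + 1) (Fin.cons (1 / w) (subTuple z Iᶜ))

/-- The hypothesis is the stability condition 2g - 1 + n > 0, which excludes exactly ω^0_1 and
ω^0_2. -/
theorem eoForm_succ (y : ℂ → ℂ) {g n : ℕ} (h : g ≠ 0 ∨ 2 ≤ n) (z : Fin (n + 1) → ℂ) :
    eoForm y g (n + 1) z = ∑ α ∈ ({1, -1} : Finset ℂ), residueAt (fun w =>
      recursionKernel y (z 0) w * (-(1 / w ^ 2)) * eoBracket y g n w (Fin.tail z)) α :=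
  eoForm.eq_4 y g n z (fun _ _ _ _ => by omega) (fun _ _ _ _ => by omega)

/-- `ω^g_{n+1}` agrees away from the branch points with a combination of products of
antisymmetric forms. -/
def IsProductCombination (y : ℂ → ℂ) (g n : ℕ) : Prop :=
  ∃ F ∈ productSpace (Finset.univ : Finset (Fin (n + 1))),
    ∀ z, AvoidsBranchPoints z → eoForm y g (n + 1) z = F z

theorem productSpace_cons {n : ℕ} {F : (Fin (n + 1) → ℂ) → ℂ}
    (hF : F ∈ productSpace Finset.univ) (α : ℂ) :
    ∃ k, (fun w z => F (Fin.cons w z)) ∈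
      separatedSpace α k (productSpace (Finset.univ : Finset (Fin n))) := by
  induction hF using Submodule.span_induction with
  | mem F h =>
    obtain ⟨f, hf, rfl⟩ := h
    obtain ⟨k, hk⟩ := poleSpace_hasOrdGE (hf 0 (Finset.mem_univ _)) α
    refine ⟨k, Submodule.subset_span ⟨f 0, fun z => ∏ i, f i.succ (z i), hk,
      Submodule.subset_span ⟨fun i => f i.succ, fun i _ => hf _ (Finset.mem_univ _), rfl⟩, ?_⟩⟩
    funext w z
    simp only [Fin.prod_univ_succ, Fin.cons_zero, Fin.cons_succ]
  | zero => exact ⟨0, Submodule.zero_mem _⟩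
  | add F G _ _ hF hG =>
    obtain ⟨k, hk⟩ := hF
    obtain ⟨l, hl⟩ := hG
    exact ⟨min k l, Submodule.add_mem _ (separatedSpace_mono (min_le_left _ _) le_rfl hk)
      (separatedSpace_mono (min_le_right _ _) le_rfl hl)⟩
  | smul c F _ hF =>
    obtain ⟨k, hk⟩ := hF
    exact ⟨k, Submodule.smul_mem _ c hk⟩

theorem productSpace_cons_one_div {n : ℕ} {F : (Fin (n + 1) → ℂ) → ℂ}
    (hF : F ∈ productSpace Finset.univ) {w : ℂ} (hw : w ≠ 0) (z : Fin n → ℂ) :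
    F (Fin.cons (1 / w) z) = w ^ 2 * F (Fin.cons w z) := by
  induction hF using Submodule.span_induction with
  | mem F h =>
    obtain ⟨f, hf, rfl⟩ := h
    simp only [Fin.prod_univ_succ, Fin.cons_zero, Fin.cons_succ]
    rw [poleSpace_one_div (hf 0 (Finset.mem_univ _)) hw, mul_assoc]
  | zero => simp
  | add F G _ _ hF hG => simp only [Pi.add_apply, hF, hG, mul_add]
  | smul c F _ hF => simp only [Pi.smul_apply, smul_eq_mul, hF]; ring

theorem productSpace_cons_cons {n : ℕ} {F : (Fin (n + 2) → ℂ) → ℂ}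
    (hF : F ∈ productSpace Finset.univ) (α : ℂ) :
    ∃ k, (fun w z => F (Fin.cons w (Fin.cons w z))) ∈
      separatedSpace α k (productSpace (Finset.univ : Finset (Fin n))) := by
  induction hF using Submodule.span_induction with
  | mem F h =>
    obtain ⟨f, hf, rfl⟩ := h
    obtain ⟨k, hk⟩ := poleSpace_hasOrdGE (hf 0 (Finset.mem_univ _)) α
    obtain ⟨l, hl⟩ := poleSpace_hasOrdGE (hf 1 (Finset.mem_univ _)) α
    refine ⟨k + l, Submodule.subset_span ⟨fun w => f 0 w * f 1 w,
      fun z => ∏ i, f i.succ.succ (z i), hk.mul hl,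
      Submodule.subset_span ⟨fun i => f i.succ.succ, fun i _ => hf _ (Finset.mem_univ _), rfl⟩,
      ?_⟩⟩
    funext w z
    simp only [Fin.prod_univ_succ, Fin.cons_zero, Fin.cons_succ, mul_assoc, Fin.succ_zero_eq_one]
  | zero => exact ⟨0, Submodule.zero_mem _⟩
  | add F G _ _ hF hG =>
    obtain ⟨k, hk⟩ := hF
    obtain ⟨l, hl⟩ := hG
    exact ⟨min k l, Submodule.add_mem _ (separatedSpace_mono (min_le_left _ _) le_rfl hk)
      (separatedSpace_mono (min_le_right _ _) le_rfl hl)⟩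
  | smul c F _ hF =>
    obtain ⟨k, hk⟩ := hF
    exact ⟨k, Submodule.smul_mem _ c hk⟩

theorem productSpace_cons_cons_one_div {n : ℕ} {F : (Fin (n + 2) → ℂ) → ℂ}
    (hF : F ∈ productSpace Finset.univ) {w : ℂ} (hw : w ≠ 0) (z : Fin n → ℂ) :
    F (Fin.cons w (Fin.cons (1 / w) z)) = w ^ 2 * F (Fin.cons w (Fin.cons w z)) := by
  induction hF using Submodule.span_induction with
  | mem F h =>
    obtain ⟨f, hf, rfl⟩ := h
    simp only [Fin.prod_univ_succ, Fin.cons_zero, Fin.cons_succ]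
    rw [poleSpace_one_div (hf _ (Finset.mem_univ _)) hw]
    ring
  | zero => simp
  | add F G _ _ hF hG => simp only [Pi.add_apply, hF, hG, mul_add]
  | smul c F _ hF => simp only [Pi.smul_apply, smul_eq_mul, hF]; ring

theorem AvoidsBranchPoints.cons {n : ℕ} {z : Fin n → ℂ} (hz : AvoidsBranchPoints z) {w : ℂ}
    (hw : w ^ 2 ≠ 1) : AvoidsBranchPoints (Fin.cons w z : Fin (n + 1) → ℂ) := by
  intro i
  refine Fin.cases ?_ (fun i => ?_) i
  · simpa using hw
  · simpa using hz i

theorem one_div_sq_ne_one {w : ℂ} (hw : w ^ 2 ≠ 1) : (1 / w) ^ 2 ≠ 1 := by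
  intro h
  apply hw
  rw [div_pow, one_pow, one_div] at h
  exact inv_eq_one.mp h

/-- A factor of the recursion: its antisymmetric part is expandable, and its symmetric part
vanishes at the branch point. -/
def IsRecursionFactor {ι : Type*} (α : ℂ) (U : Submodule ℂ ((ι → ℂ) → ℂ))
    (u : ℂ → (ι → ℂ) → ℂ) : Prop :=
  IsExpandable α U (fun w z => u w z + 1 / w ^ 2 * u (1 / w) z) ∧
    ∀ z, AvoidsBranchPoints z → HasOrdGE α 1 (fun w => u w z - 1 / w ^ 2 * u (1 / w) z)

theorem IsProductCombination.isRecursionFactor {y : ℂ → ℂ} {g n : ℕ} {α : ℂ} (hα : α ^ 2 = 1)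
    (h : IsProductCombination y g n) :
    IsRecursionFactor α (productSpace (Finset.univ : Finset (Fin n)))
      (fun w z => eoForm y g (n + 1) (Fin.cons w z)) := by
  obtain ⟨F, hF, he⟩ := h
  have key : ∀ z : Fin n → ℂ, AvoidsBranchPoints z → ∀ w : ℂ, w ≠ 0 → w ^ 2 ≠ 1 →
      eoForm y g (n + 1) (Fin.cons w z) = F (Fin.cons w z) ∧
      1 / w ^ 2 * eoForm y g (n + 1) (Fin.cons (1 / w) z) = F (Fin.cons w z) := by
    intro z hz w h0 h1
    refine ⟨he _ (hz.cons h1), ?_⟩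
    rw [he _ (hz.cons (one_div_sq_ne_one h1)), productSpace_cons_one_div hF h0]
    field_simp
  obtain ⟨k, hk⟩ := productSpace_cons hF α
  refine ⟨((IsExpandable.of_mem hk).smul 2).congr fun z hz => ?_, fun z hz => ?_⟩
  · filter_upwards [eventually_punctured_ne hα] with w hw
    obtain ⟨h1, h2⟩ := key z hz w hw.1 hw.2
    rw [h1, h2]
    simp only [Pi.smul_apply, smul_eq_mul]
    ring
  · refine HasOrdGE.zero.congr ?_
    filter_upwards [eventually_punctured_ne hα] with w hw
    obtain ⟨h1, h2⟩ := key z hz w hw.1 hw.2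
    rw [h1, h2]
    simp

theorem isRecursionFactor_bergmann (y : ℂ → ℂ) {α : ℂ} (hα : α ^ 2 = 1) :
    IsRecursionFactor α (productSpace (Finset.univ : Finset (Fin 1)))
      (fun w z => eoForm y 0 2 (Fin.cons w z)) := by
  have h : ∀ (w : ℂ) (z : Fin 1 → ℂ), eoForm y 0 2 (Fin.cons w z) = bergmann w (z 0) := by
    intro w z
    rw [eoForm]
    rfl
  simp only [h]
  exact ⟨isExpandable_bergmann hα 0, fun z hz => hasOrdGE_bergmann_sub hα (hz.ne hα 0)⟩

theorem IsRecursionFactor.subTuple {n : ℕ} {α : ℂ} {I : Finset (Fin n)}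
    {u : ℂ → (Fin I.card → ℂ) → ℂ}
    (h : IsRecursionFactor α (productSpace (Finset.univ : Finset (Fin I.card))) u) :
    IsRecursionFactor α (productSpace I) (fun w z => u w (subTuple z I)) := by
  refine ⟨?_, fun z hz => h.2 _ fun i => hz _⟩
  have := h.1.comp (I.orderEmbOfFin rfl).toEmbedding
  rw [Finset.map_orderEmbOfFin_univ] at this
  exact this

/-- A pair of terms of the recursion that are exchanged by `w ↦ 1/w`. -/
theorem IsRecursionFactor.mul {n : ℕ} {α : ℂ} {I J : Finset (Fin n)}
    (hIJ : Disjoint I J) (hIJ' : I ∪ J = Finset.univ) {u v : ℂ → (Fin n → ℂ) → ℂ}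
    (hu : IsRecursionFactor α (productSpace I) u) (hv : IsRecursionFactor α (productSpace J) v) :
    IsExpandableMod α 2 (productSpace (Finset.univ : Finset (Fin n)))
      (fun w z => -(1 / w ^ 2) * (u w z * v (1 / w) z + v w z * u (1 / w) z)) := by
  have h1 := ((hu.1.mul hv.1).mono (productSpace_mul hIJ)).smul (-(1 / 2))
  rw [hIJ'] at h1
  refine ⟨_, h1, fun z hz => ?_⟩
  -- With u± = u(w) ± w⁻² u(1/w), and likewise v±, the paired term equals -u₊v₊/2 + u₋v₋/2: the
  -- mixed products cancel. Both u₋ and v₋ vanish at α, hence the order 2.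
  refine (((hu.2 z hz).mul (hv.2 z hz)).const_mul (1 / 2)).congr
    (Eventually.of_forall fun w => ?_)
  simp only [Pi.smul_apply, Pi.mul_apply, smul_eq_mul]
  ring

/-- The terms of the recursion, for arbitrary genera and sets of variables. -/
noncomputable def eoTerm (y : ℂ → ℂ) {n : ℕ} (a b : ℕ) (I J : Finset (Fin n)) (w : ℂ)
    (z : Fin n → ℂ) : ℂ :=
  if (a = 0 ∧ I = ∅) ∨ (b = 0 ∧ J = ∅) then 0
  else eoForm y a (I.card + 1) (Fin.cons w (subTuple z I)) *
    eoForm y b (J.card + 1) (Fin.cons (1 / w) (subTuple z J))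

/-- The sum is invariant under (g₁, I) ↦ (g - g₁, Iᶜ) and may be averaged with its image. This
produces the pairs in which the mixed parts cancel. -/
theorem eoBracket_eq (y : ℂ → ℂ) (g n : ℕ) (w : ℂ) (z : Fin n → ℂ) :
    eoBracket y g n w z =
      (if 1 ≤ g then eoForm y (g - 1) (n + 2) (Fin.cons w (Fin.cons (1 / w) z)) else 0) +
      ∑ g₁ : Fin (g + 1), ∑ I : Finset (Fin n), (1 / 2) *
        (eoTerm y g₁ (g - g₁) I Iᶜ w z + eoTerm y (g - g₁) g₁ Iᶜ I w z) := by
  have h : ∑ g₁ : Fin (g + 1), ∑ I : Finset (Fin n), eoTerm y g₁ (g - g₁) I Iᶜ w z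
      = ∑ g₁ : Fin (g + 1), ∑ I : Finset (Fin n), eoTerm y (g - g₁) g₁ Iᶜ I w z := by
    rw [← Equiv.sum_comp Fin.revPerm]
    refine Finset.sum_congr rfl fun g₁ _ => ?_
    rw [← Equiv.sum_comp (Function.Involutive.toPerm _ (compl_involutive (α := Finset (Fin n))))]
    refine Finset.sum_congr rfl fun I _ => ?_
    have e1 : ((Fin.revPerm g₁ : Fin (g + 1)) : ℕ) = g - g₁ := by
      rw [Fin.revPerm_apply, Fin.val_rev]
      omega
    have e2 : g - (g - (g₁ : ℕ)) = g₁ := by have := g₁.isLt; omega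
    rw [e1, e2, Function.Involutive.coe_toPerm, compl_compl]
  have h' : ∑ g₁ : Fin (g + 1), ∑ I : Finset (Fin n), (1 / 2) *
        (eoTerm y g₁ (g - g₁) I Iᶜ w z + eoTerm y (g - g₁) g₁ Iᶜ I w z)
      = ∑ g₁ : Fin (g + 1), ∑ I : Finset (Fin n), eoTerm y g₁ (g - g₁) I Iᶜ w z := by
    simp only [← Finset.mul_sum, Finset.sum_add_distrib]
    rw [← h]
    ring
  rw [h', eoBracket]
  rfl

theorem isExpandableMod_eoBracket (y : ℂ → ℂ) {g n : ℕ} (hgn : g ≠ 0 ∨ 2 ≤ n) {α : ℂ}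
    (hα : α ^ 2 = 1)
    (ih : ∀ a b : ℕ, 2 * a + b < 2 * g + n → (a ≠ 0 ∨ 2 ≤ b) → IsProductCombination y a b) :
    IsExpandableMod α 2 (productSpace (Finset.univ : Finset (Fin n)))
      (fun w z => -(1 / w ^ 2) * eoBracket y g n w z) := by
  have hfac : ∀ a b : ℕ, 2 * a + b < 2 * g + n → (a ≠ 0 ∨ b ≠ 0) →
      IsRecursionFactor α (productSpace (Finset.univ : Finset (Fin b)))
        (fun w z => eoForm y a (b + 1) (Fin.cons w z)) := by
    intro a b hlt hab
    by_cases h : a ≠ 0 ∨ 2 ≤ b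
    · exact (ih a b hlt h).isRecursionFactor hα
    · obtain ⟨rfl, rfl⟩ : a = 0 ∧ b = 1 := by omega
      exact isRecursionFactor_bergmann y hα
  have hterm : ∀ (g₁ : Fin (g + 1)) (I : Finset (Fin n)),
      IsExpandableMod α 2 (productSpace (Finset.univ : Finset (Fin n)))
      (fun w z => -(1 / w ^ 2) *
        (eoTerm y g₁ (g - g₁) I Iᶜ w z + eoTerm y (g - g₁) g₁ Iᶜ I w z)) := by
    intro g₁ I
    by_cases h : ((g₁ : ℕ) = 0 ∧ I = ∅) ∨ (g - g₁ = 0 ∧ Iᶜ = ∅)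
    · have e1 : ∀ w z, eoTerm y g₁ (g - g₁) I Iᶜ w z = 0 := fun w z => if_pos h
      have e2 : ∀ w z, eoTerm y (g - g₁) g₁ Iᶜ I w z = 0 := fun w z => if_pos h.symm
      simp only [e1, e2, add_zero, mul_zero]
      exact IsExpandableMod.of_isExpandable IsExpandable.zero
    · have e1 : ∀ w z, eoTerm y g₁ (g - g₁) I Iᶜ w z =
          eoForm y g₁ (I.card + 1) (Fin.cons w (subTuple z I)) *
            eoForm y (g - g₁) (Iᶜ.card + 1) (Fin.cons (1 / w) (subTuple z Iᶜ)) :=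
        fun w z => if_neg h
      have e2 : ∀ w z, eoTerm y (g - g₁) g₁ Iᶜ I w z =
          eoForm y (g - g₁) (Iᶜ.card + 1) (Fin.cons w (subTuple z Iᶜ)) *
            eoForm y g₁ (I.card + 1) (Fin.cons (1 / w) (subTuple z I)) :=
        fun w z => if_neg fun h' => h h'.symm
      simp only [e1, e2]
      rw [not_or, ← Finset.card_eq_zero, ← Finset.card_eq_zero] at h
      have hc : I.card + Iᶜ.card = n := by simp
      have hg : (g₁ : ℕ) < g + 1 := g₁.isLt
      clear e1 e2
      have hu := IsRecursionFactor.subTuple (hfac g₁ I.card (by omega) (by omega))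
      have hv := IsRecursionFactor.subTuple (hfac (g - g₁) Iᶜ.card (by omega) (by omega))
      have hm := IsRecursionFactor.mul disjoint_compl_right (Finset.union_compl I) hu hv
      exact hm
  have hsum := IsExpandableMod.sum (S := Finset.univ) fun g₁ _ =>
    IsExpandableMod.sum (S := Finset.univ) fun I _ => (hterm g₁ I).smul (1 / 2)
  have hfirst : IsExpandable α (productSpace (Finset.univ : Finset (Fin n))) (fun w z =>
      -(1 / w ^ 2) * (if 1 ≤ g then
        eoForm y (g - 1) (n + 2) (Fin.cons w (Fin.cons (1 / w) z)) else 0)) := by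
    by_cases hg : 1 ≤ g
    · simp only [if_pos hg]
      by_cases h : g - 1 ≠ 0 ∨ 2 ≤ n + 1
      · obtain ⟨F, hF, he⟩ := ih (g - 1) (n + 1) (by omega) h
        obtain ⟨k, hk⟩ := productSpace_cons_cons hF α
        refine ((IsExpandable.of_mem hk).smul (-1)).congr fun z hz => ?_
        filter_upwards [eventually_punctured_ne hα] with w hw
        have hw1 := hw.1
        rw [he _ ((hz.cons (one_div_sq_ne_one hw.2)).cons hw.2),
          productSpace_cons_cons_one_div hF hw.1]
        simp only [Pi.smul_apply, smul_eq_mul]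
        field_simp
      -- For ω^1_1 the first term is B(w, 1/w), a function of w alone with a double pole at α.
      · obtain ⟨hg1, rfl⟩ : g - 1 = 0 ∧ n = 0 := by omega
        have h1 : HasOrdGE α (-2) (fun w => ((w - 1 / w) ^ 2)⁻¹) := by
          have h0 := ne_zero_of_sq_eq_one hα
          refine HasOrdGE.inv (m := 2) (φ := fun w => ((w + α) / w) ^ 2)
            (by fun_prop (disch := assumption)) (by simp [← two_mul, h0]) ?_
          filter_upwards [eventually_punctured_ne hα] with w hw
          have hw1 := hw.1
          have e : w - 1 / w = (w - α) * ((w + α) / w) := by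
            field_simp
            linear_combination hα
          rw [e, mul_pow]
          norm_cast
        have h2 : HasOrdGE α 0 (fun w => -(1 / w ^ 2)) := by
          have h0 : α ^ 2 ≠ 0 := pow_ne_zero 2 (ne_zero_of_sq_eq_one hα)
          exact AnalyticAt.hasOrdGE_zero (by fun_prop (disch := assumption))
        have h3 := IsExpandable.of_hasOrdGE (ι := Fin 0) (h2.mul h1)
        have h4 : (Finset.univ : Finset (Fin 0)) = ∅ := rfl
        rw [h4]
        refine h3.congr fun z _ => Eventually.of_forall fun w => ?_
        rw [hg1]
        congr 1
        rw [eoForm]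
        exact one_div _
    · simp only [if_neg hg, mul_zero]
      exact IsExpandable.zero
  refine ((IsExpandableMod.of_isExpandable hfirst).add hsum).congr
    fun z _ => Eventually.of_forall fun w => ?_
  rw [eoBracket_eq]
  simp only [Pi.add_apply, Finset.sum_apply, Pi.smul_apply, smul_eq_mul, mul_add, Finset.mul_sum]
  congr 1
  refine Finset.sum_congr rfl fun g₁ _ => Finset.sum_congr rfl fun I _ => ?_
  ring

theorem isProductCombination_eoForm {y : ℂ → ℂ} (hy : IsRegularAtBranchPoints y) (g n : ℕ)
    (hgn : g ≠ 0 ∨ 2 ≤ n) : IsProductCombination y g n := by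
  induction hN : 2 * g + n using Nat.strong_induction_on generalizing g n with
  | _ N ih =>
    subst hN
    have key : ∀ α : ℂ, α ^ 2 = 1 → ∃ F ∈ productSpace (Finset.univ : Finset (Fin (n + 1))),
        ∀ z, AvoidsBranchPoints z → HasResidue (fun w => recursionKernel y (z 0) w *
          (-(1 / w ^ 2)) * eoBracket y g n w (Fin.tail z)) α (F z) := by
      intro α hα
      have h1 := (isExpandableMod_eoBracket y hgn hα
        fun a b hab h => ih _ hab a b h rfl).comp (Fin.succEmb n)
      have h2 : IsExpandable α (productSpace ({0} : Finset (Fin (n + 1))))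
          (fun w z => recursionKernel y (z 0) w) := by
        have h3 := ((IsExpandable.of_hasOrdGE (ι := Fin (n + 1))
          ((kernelDenom_hasOrdGE hy hα).const_mul (-(1 / 2)))).mul
          (isExpandable_bergmannIntegral hα 0)).mono (productSpace_mul (by simp))
        rw [Finset.empty_union] at h3
        exact h3.congr fun z _ => Eventually.of_forall fun w => recursionKernel_eq y (z 0) w
      have h4 : ∀ z : Fin (n + 1) → ℂ, AvoidsBranchPoints z →
          HasOrdGE α (-1) (fun w => recursionKernel y (z 0) w) := by
        intro z hz
        refine (((kernelDenom_hasOrdGE hy hα).const_mul (-(1 / 2))).mul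
          (bergmannIntegral_hasOrdGE hα (hz.ne hα 0))).congr
          (Eventually.of_forall fun w => recursionKernel_eq y (z 0) w)
      -- The kernel has order at least -1 and the bracket is expandable up to order 2, so the
      -- unexpanded part of the product has order at least 1 and no residue.
      obtain ⟨F, hF, h5⟩ := (IsExpandableMod.mul h2 h4 h1).hasResidue (by norm_num)
      refine ⟨F, ?_, fun z hz => (h5 z hz).congr (Eventually.of_forall fun w => ?_)⟩
      · refine (productSpace_mul ?_).trans (le_of_eq ?_) hF
        · simp
        · congr 1
          ext i
          refine Fin.cases ?_ (fun i => ?_) i <;> simp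
      · simp only [Pi.mul_apply]
        rw [mul_assoc]
        rfl
    obtain ⟨F, hF, h1⟩ := key 1 (by norm_num)
    obtain ⟨G, hG, h2⟩ := key (-1) (by norm_num)
    refine ⟨F + G, Submodule.add_mem _ hF hG, fun z hz => ?_⟩
    rw [eoForm_succ y hgn, Finset.sum_pair (by norm_num), (h1 z hz).residueAt_eq,
      (h2 z hz).residueAt_eq]
    rfl

end Structure

/-! ### The one-point invariants -/

section OnePoint

theorem eq_one_or_eq_neg_one_of_sq_eq_one {α : ℂ} (hα : α ^ 2 = 1) : α = 1 ∨ α = -1 :=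
  sq_eq_sq_iff_eq_or_eq_neg.mp (by rw [hα, one_pow])

theorem poleSpace_mul_one_div {q : ℂ → ℂ} (hq : q ∈ poleSpace * poleSpace) {w : ℂ} (hw : w ≠ 0) :
    q (1 / w) = w ^ 4 * q w := by
  induction hq using Submodule.mul_induction_on' with
  | mem_mul_mem f hf f' hf' =>
    simp only [Pi.mul_apply, poleSpace_one_div hf hw, poleSpace_one_div hf' hw]
    ring
  | add f _ f' _ hf hf' => simp only [Pi.add_apply, hf, hf', mul_add]

theorem poleSpace_mul_hasOrdGE {q : ℂ → ℂ} (hq : q ∈ poleSpace * poleSpace) (α : ℂ) :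
    ∃ m, HasOrdGE α m q := by
  induction hq using Submodule.mul_induction_on' with
  | mem_mul_mem f hf f' hf' =>
    obtain ⟨m, hm⟩ := poleSpace_hasOrdGE hf α
    obtain ⟨n, hn⟩ := poleSpace_hasOrdGE hf' α
    exact ⟨_, hm.mul hn⟩
  | add f _ f' _ hf hf' =>
    obtain ⟨m, hm⟩ := hf
    obtain ⟨n, hn⟩ := hf'
    exact ⟨min m n, (hm.mono (min_le_left _ _)).add (hn.mono (min_le_right _ _))⟩

theorem productSpace_cons_mem_poleSpace {n : ℕ} {F : (Fin (n + 1) → ℂ) → ℂ}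
    (hF : F ∈ productSpace Finset.univ) (z : Fin n → ℂ) :
    (fun w => F (Fin.cons w z)) ∈ poleSpace := by
  induction hF using Submodule.span_induction with
  | mem F h =>
    obtain ⟨f, hf, rfl⟩ := h
    simp only [Fin.prod_univ_succ, Fin.cons_zero, Fin.cons_succ]
    have := Submodule.smul_mem _ (∏ i, f (Fin.succ i) (z i)) (hf 0 (Finset.mem_univ _))
    convert this using 1
    funext w
    simp [mul_comm]
  | zero => exact Submodule.zero_mem _
  | add F G _ _ hF hG => exact Submodule.add_mem _ hF hG
  | smul c F _ hF => exact Submodule.smul_mem _ c hF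

theorem productSpace_cons_cons_mem {n : ℕ} {F : (Fin (n + 2) → ℂ) → ℂ}
    (hF : F ∈ productSpace Finset.univ) (z : Fin n → ℂ) :
    (fun w => F (Fin.cons w (Fin.cons w z))) ∈ poleSpace * poleSpace := by
  induction hF using Submodule.span_induction with
  | mem F h =>
    obtain ⟨f, hf, rfl⟩ := h
    have := Submodule.smul_mem _ (∏ i, f (Fin.succ (Fin.succ i)) (z i))
      (Submodule.mul_mem_mul (hf 0 (Finset.mem_univ _)) (hf 1 (Finset.mem_univ _)))
    convert this using 1
    funext w
    simp only [Fin.prod_univ_succ, Fin.cons_zero, Fin.cons_succ, Fin.succ_zero_eq_one,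
      Pi.smul_apply, Pi.mul_apply, smul_eq_mul]
    ring
  | zero => exact Submodule.zero_mem _
  | add F G _ _ hF hG => exact Submodule.add_mem _ hF hG
  | smul c F _ hF => exact Submodule.smul_mem _ c hF

/-- For `g > 1` the quadratic differential in the recursion for `ω^g_1` is a combination of
products of two antisymmetric forms. -/
theorem exists_eoBracket_eq {y : ℂ → ℂ} (hy : IsRegularAtBranchPoints y) {g : ℕ} (hg : 1 < g)
    (z : Fin 0 → ℂ) : ∃ q ∈ poleSpace * poleSpace, ∀ w : ℂ, w ≠ 0 → w ^ 2 ≠ 1 →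
      -(1 / w ^ 2) * eoBracket y g 0 w z = q w := by
  have hz : AvoidsBranchPoints z := fun i => i.elim0
  have hterm : ∀ (g₁ : Fin (g + 1)) (I : Finset (Fin 0)), ∃ q ∈ poleSpace * poleSpace,
      ∀ w : ℂ, w ≠ 0 → w ^ 2 ≠ 1 → -(1 / w ^ 2) * eoTerm y g₁ (g - g₁) I Iᶜ w z = q w := by
    intro g₁ I
    by_cases h : ((g₁ : ℕ) = 0 ∧ I = ∅) ∨ (g - g₁ = 0 ∧ Iᶜ = ∅)
    · refine ⟨0, Submodule.zero_mem _, fun w _ _ => ?_⟩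
      rw [eoTerm, if_pos h, mul_zero]
      rfl
    · have h1 : (g₁ : ℕ) ≠ 0 := fun h1 => h (Or.inl ⟨h1, Subsingleton.elim _ _⟩)
      have h2 : g - (g₁ : ℕ) ≠ 0 := fun h2 => h (Or.inr ⟨h2, Subsingleton.elim _ _⟩)
      obtain ⟨F, hF, hF'⟩ := isProductCombination_eoForm hy g₁ I.card (Or.inl h1)
      obtain ⟨G, hG, hG'⟩ := isProductCombination_eoForm hy (g - g₁) Iᶜ.card (Or.inl h2)
      refine ⟨_, Submodule.neg_mem _ (Submodule.mul_mem_mul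
        (productSpace_cons_mem_poleSpace hF (subTuple z I))
        (productSpace_cons_mem_poleSpace hG (subTuple z Iᶜ))), fun w hw hw2 => ?_⟩
      have a1 : AvoidsBranchPoints (subTuple z I) := fun i => hz _
      have a2 : AvoidsBranchPoints (subTuple z Iᶜ) := fun i => hz _
      rw [eoTerm, if_neg h, hF' _ (a1.cons hw2), hG' _ (a2.cons (one_div_sq_ne_one hw2)),
        productSpace_cons_one_div hG hw]
      simp only [Pi.neg_apply, Pi.mul_apply]
      field_simp
  choose Q hQ hQ' using hterm
  obtain ⟨F, hF, hF'⟩ := isProductCombination_eoForm hy (g - 1) 1 (Or.inl (by omega))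
  refine ⟨-(fun w => F (Fin.cons w (Fin.cons w z))) + ∑ g₁, ∑ I, Q g₁ I,
    Submodule.add_mem _ (Submodule.neg_mem _ (productSpace_cons_cons_mem hF z))
      (Submodule.sum_mem _ fun g₁ _ => Submodule.sum_mem _ fun I _ => hQ g₁ I),
    fun w hw hw2 => ?_⟩
  have e : eoBracket y g 0 w z =
      eoForm y (g - 1) 2 (Fin.cons w (Fin.cons (1 / w) z)) +
      ∑ g₁ : Fin (g + 1), ∑ I : Finset (Fin 0), eoTerm y g₁ (g - g₁) I Iᶜ w z := by
    rw [eoBracket, dif_pos (by omega : 1 ≤ g)]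
    rfl
  rw [e, hF' _ ((hz.cons (one_div_sq_ne_one hw2)).cons hw2), mul_add,
    productSpace_cons_cons_one_div hF hw]
  simp only [Pi.add_apply, Pi.neg_apply, Finset.sum_apply, Finset.mul_sum, hQ' _ _ w hw hw2]
  congr 1
  field_simp

theorem curveDX_one_div {w : ℂ} (hw : w ≠ 0) : curveDX (1 / w) = -w ^ 2 * curveDX w := by
  rw [curveDX, curveDX]
  field_simp
  ring

theorem kernelDenom_one_div (y : ℂ → ℂ) {w : ℂ} (hw : w ≠ 0) :
    kernelDenom y (1 / w) = (w ^ 2)⁻¹ * kernelDenom y w := by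
  rw [kernelDenom, kernelDenom, curveDX_one_div hw, one_div_one_div, ← mul_inv]
  congr 1
  ring

/-- The quadratic differential q and dx are invariant under w ↦ 1/w, while y - ŷ changes sign. -/
theorem isAntisymmAt_kernelDenom_mul (y : ℂ → ℂ) {q : ℂ → ℂ} (hq : q ∈ poleSpace * poleSpace)
    {α : ℂ} (hα : α ^ 2 = 1) : IsAntisymmAt (fun w => kernelDenom y w * q w) α := by
  filter_upwards [eventually_punctured_ne hα] with w hw
  have hw1 := hw.1
  rw [kernelDenom_one_div y hw.1, poleSpace_mul_one_div hq hw.1]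
  field_simp

/-- `ω^g_1` is an antisymmetric form `ω`, and `ω + q / ((y(w) - y(1/w)) dx)` is regular at the
branch points for the quadratic differential `q` of the recursion. -/
theorem exists_onePointForm {y : ℂ → ℂ} (hy : IsRegularAtBranchPoints y) {g : ℕ} (hg : 1 < g) :
    ∃ ω ∈ poleSpace, ∃ q ∈ poleSpace * poleSpace,
      (∀ z : ℂ, z ^ 2 ≠ 1 → eoForm y g 1 (fun _ => z) = ω z) ∧
      ∀ α : ℂ, α ^ 2 = 1 → HasOrdGE α 0 (fun w => ω w + kernelDenom y w * q w) := by
  obtain ⟨q, hq, hq'⟩ := exists_eoBracket_eq hy hg Fin.elim0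
  have key : ∀ α : ℂ, α ^ 2 = 1 → ∃ F ∈ poleSpace, (∀ β, β ≠ α → AnalyticAt ℂ F β) ∧
      HasOrdGE α 0 (fun w => F w + kernelDenom y w * q w) ∧
      ∀ z : ℂ, z ^ 2 ≠ 1 → HasResidue (fun w => recursionKernel y z w *
        (-(1 / w ^ 2)) * eoBracket y g 0 w Fin.elim0) α (F z) := by
    intro α hα
    obtain ⟨m, hm⟩ := poleSpace_mul_hasOrdGE hq α
    obtain ⟨j, e, he⟩ := (isAntisymmAt_kernelDenom_mul y hq hα).exists_sum hα
      ((kernelDenom_hasOrdGE hy hα).mul hm)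
    -- The coefficient -e i is the product of the factor -1/2 in the kernel, the factor 2 in the
    -- reproducing property of the Bergmann integral, and the coefficient e i of the principal part.
    refine ⟨∑ i ∈ Finset.range j, (-e i) • poleForm α i,
      Submodule.sum_mem _ fun i _ => Submodule.smul_mem _ _ (poleForm_mem hα i), ?_, ?_, ?_⟩
    · intro β hβ
      exact Finset.analyticAt_sum _ fun i _ => (poleForm_analyticAt hβ i).const_smul
    · refine he.congr (Eventually.of_forall fun w => ?_)
      simp only [Finset.sum_apply, Pi.smul_apply, smul_eq_mul, neg_mul, Finset.sum_neg_distrib]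
      ring
    · intro z hz
      have hzα : z ≠ α := fun h => hz (h ▸ hα)
      have h1 : HasResidue (fun w => -(1 / 2) * (bergmannIntegral z (1 / w) w *
          (kernelDenom y w * q w - ∑ i ∈ Finset.range j, e i * poleForm α i w))) α (-(1 / 2) * 0) :=
        (hasResidue_zero_of_hasOrdGE
          (((bergmannIntegral_analyticAt hα hzα).hasOrdGE_zero).mul he)).const_mul _
      have h2 : HasResidue (fun w => ∑ i ∈ Finset.range j, (-(1 / 2) * e i) *
          (bergmannIntegral z (1 / w) w * poleForm α i w)) α
          (∑ i ∈ Finset.range j, (-(1 / 2) * e i) * (2 * poleForm α i z)) :=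
        HasResidue.sum fun i _ => (hasResidue_bergmannIntegral_mul_poleForm hα hzα i).const_mul _
      have h3 := h1.add h2
      have h4 : -(1 / 2) * 0 + ∑ i ∈ Finset.range j, (-(1 / 2) * e i) * (2 * poleForm α i z)
          = (∑ i ∈ Finset.range j, (-e i) • poleForm α i) z := by
        simp only [Finset.sum_apply, Pi.smul_apply, smul_eq_mul]
        rw [mul_zero, zero_add]
        exact Finset.sum_congr rfl fun i _ => by ring
      rw [h4] at h3
      refine h3.congr ?_
      filter_upwards [eventually_punctured_ne hα] with w hw
      rw [mul_assoc, hq' w hw.1 hw.2, recursionKernel_eq, mul_sub, Finset.mul_sum, mul_sub,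
        Finset.mul_sum, sub_add_eq_add_sub, add_sub_assoc, ← Finset.sum_sub_distrib]
      rw [Finset.sum_eq_zero fun i _ => by ring]
      ring
  obtain ⟨F, hF, hFa, hFo, hFr⟩ := key 1 (by norm_num)
  obtain ⟨G, hG, hGa, hGo, hGr⟩ := key (-1) (by norm_num)
  refine ⟨F + G, Submodule.add_mem _ hF hG, q, hq, fun z hz => ?_, fun α hα => ?_⟩
  · rw [eoForm_succ y (Or.inl (by omega)), Finset.sum_pair (by norm_num)]
    have e : (Fin.tail fun _ : Fin (0 + 1) => z) = (Fin.elim0 : Fin 0 → ℂ) := Subsingleton.elim _ _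
    rw [e, (hFr z hz).residueAt_eq, (hGr z hz).residueAt_eq]
    rfl
  · rcases eq_one_or_eq_neg_one_of_sq_eq_one hα with rfl | rfl
    -- The contribution of the other branch point is analytic here.
    · exact (hFo.add (hGa 1 (by norm_num)).hasOrdGE_zero).congr
        (Eventually.of_forall fun w => by simp only [Pi.add_apply]; ring)
    · exact (hGo.add (hFa (-1) (by norm_num)).hasOrdGE_zero).congr
        (Eventually.of_forall fun w => by simp only [Pi.add_apply]; ring)

end OnePoint

/-! ### Sums of residues over the branch points -/

/-- The residues of `f` at `1` and `-1` have the sum `r`. -/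
def HasResidueSum (f : ℂ → ℂ) (r : ℂ) : Prop :=
  ∃ r₁ r₂ : ℂ, HasResidue f 1 r₁ ∧ HasResidue f (-1) r₂ ∧ r = r₁ + r₂

namespace HasResidueSum

variable {f g : ℂ → ℂ} {r s : ℂ}

theorem unique (h : HasResidueSum f r) (h' : HasResidueSum f s) : r = s := by
  obtain ⟨a, b, h1, h2, rfl⟩ := h
  obtain ⟨c, d, h3, h4, rfl⟩ := h'
  rw [h1.unique h3, h2.unique h4]

theorem congr (h : HasResidueSum f r) (hfg : ∀ w, w ≠ 0 → w ^ 2 ≠ 1 → g w = f w) :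
    HasResidueSum g r := by
  obtain ⟨a, b, h1, h2, rfl⟩ := h
  exact ⟨a, b, h1.congr ((eventually_punctured_ne (by norm_num)).mono fun w hw =>
    hfg w hw.1 hw.2), h2.congr ((eventually_punctured_ne (by norm_num)).mono fun w hw =>
    hfg w hw.1 hw.2), rfl⟩

theorem add (h : HasResidueSum f r) (h' : HasResidueSum g s) :
    HasResidueSum (fun w => f w + g w) (r + s) := by
  obtain ⟨a, b, h1, h2, rfl⟩ := h
  obtain ⟨c, d, h3, h4, rfl⟩ := h'
  exact ⟨_, _, h1.add h3, h2.add h4, by ring⟩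

theorem const_mul (c : ℂ) (h : HasResidueSum f r) :
    HasResidueSum (fun w => c * f w) (c * r) := by
  obtain ⟨a, b, h1, h2, rfl⟩ := h
  exact ⟨_, _, h1.const_mul c, h2.const_mul c, by ring⟩

theorem zero : HasResidueSum (fun _ => 0) 0 :=
  ⟨0, 0, hasResidue_zero_of_hasOrdGE analyticAt_const.hasOrdGE_zero,
    hasResidue_zero_of_hasOrdGE analyticAt_const.hasOrdGE_zero, by simp⟩

theorem sum {ι : Type*} {S : Finset ι} {f : ι → ℂ → ℂ} {r : ι → ℂ}
    (h : ∀ i ∈ S, HasResidueSum (f i) (r i)) :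
    HasResidueSum (fun w => ∑ i ∈ S, f i w) (∑ i ∈ S, r i) := by
  classical
  induction S using Finset.induction_on with
  | empty => simpa using zero
  | insert i S hi ih =>
    simp only [Finset.sum_insert hi]
    exact (h i (by simp)).add (ih fun j hj => h j (by simp [hj]))

end HasResidueSum

/-- The pullback of the differential `dx / ((x - 2)^a (x + 2)^b)`. -/
noncomputable def pulledBackForm (a b : ℕ) (w : ℂ) : ℂ :=
  ((curveX w - 2) ^ a)⁻¹ * ((curveX w + 2) ^ b)⁻¹ * curveDX w

theorem curveX_sub {β w : ℂ} (hβ : β ^ 2 = 1) (hw : w ≠ 0) :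
    curveX w - 2 * β = (w - β) ^ 2 / w := by
  rw [curveX]
  field_simp
  linear_combination -hβ

theorem curveX_sub_ne_zero {β w : ℂ} (hβ : β ^ 2 = 1) (hw : w ≠ 0) (hw2 : w ^ 2 ≠ 1) :
    curveX w - 2 * β ≠ 0 := by
  rw [curveX_sub hβ hw]
  refine div_ne_zero (pow_ne_zero 2 (sub_ne_zero.mpr ?_)) hw
  rintro rfl
  exact hw2 hβ

theorem curveX_sub_two_ne_zero {w : ℂ} (hw : w ≠ 0) (hw2 : w ^ 2 ≠ 1) : curveX w - 2 ≠ 0 := by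
  simpa using curveX_sub_ne_zero (β := 1) (by norm_num) hw hw2

theorem curveX_add_two_ne_zero {w : ℂ} (hw : w ≠ 0) (hw2 : w ^ 2 ≠ 1) : curveX w + 2 ≠ 0 := by
  simpa using curveX_sub_ne_zero (β := -1) (by norm_num) hw hw2

theorem analyticAt_curveX {w : ℂ} (hw : w ≠ 0) : AnalyticAt ℂ curveX w := by
  unfold curveX
  fun_prop (disch := assumption)

theorem analyticAt_curveDX {w : ℂ} (hw : w ≠ 0) : AnalyticAt ℂ curveDX w := by
  have : w ^ 2 ≠ 0 := pow_ne_zero 2 hw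
  unfold curveDX
  fun_prop (disch := assumption)

theorem hasOrdGE_curveX_sub_pow_inv {α β : ℂ} (hα : α ^ 2 = 1) (hβ : β ^ 2 = 1) (a : ℕ) :
    ∃ m, HasOrdGE α m (fun w => ((curveX w - 2 * β) ^ a)⁻¹) := by
  have h0 := ne_zero_of_sq_eq_one hα
  rcases eq_or_ne α β with rfl | h
  · refine ⟨-(2 * a : ℕ), HasOrdGE.inv (φ := fun w => (w⁻¹) ^ a) (by fun_prop (disch := assumption))
      (pow_ne_zero _ (inv_ne_zero h0)) ?_⟩
    filter_upwards [eventually_punctured_ne hα] with w hw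
    rw [curveX_sub hα hw.1, zpow_natCast, div_pow, pow_mul, inv_pow, div_eq_mul_inv]
  · refine ⟨0, AnalyticAt.hasOrdGE_zero ?_⟩
    refine AnalyticAt.inv (((analyticAt_curveX h0).fun_sub analyticAt_const).fun_pow a)
      (pow_ne_zero _ ?_)
    rw [curveX_sub hβ h0]
    exact div_ne_zero (pow_ne_zero 2 (sub_ne_zero.mpr h)) h0

/-- `dx / (x - 2β)^a`, at the branch point `α`. -/
theorem hasResidue_curveX_sub_pow_inv {α β : ℂ} (hα : α ^ 2 = 1) (hβ : β ^ 2 = 1) (a : ℕ) :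
    HasResidue (fun w => ((curveX w - 2 * β) ^ (a + 1))⁻¹ * curveDX w) α
      (if a = 0 ∧ α = β then 2 else 0) := by
  have h0 := ne_zero_of_sq_eq_one hα
  rcases Nat.eq_zero_or_pos a with rfl | ha
  · rcases eq_or_ne α β with rfl | h
    · have a1 : AnalyticAt ℂ (fun w => (w + α) / w) α := by fun_prop (disch := assumption)
      have a2 := a1.hasResidue_zpow_mul 0
      have a3 : iteratedDeriv 0 (fun w => (w + α) / w) α / (Nat.factorial 0 : ℂ) = 2 := by
        simp
        field_simp
        norm_num
      rw [a3] at a2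
      rw [if_pos (by simp)]
      refine a2.congr ?_
      filter_upwards [eventually_punctured_ne hα, self_mem_nhdsWithin] with w hw hw2
      have b1 := hw.1
      have b2 : w - α ≠ 0 := sub_ne_zero.mpr hw2
      rw [curveX_sub hα hw.1, curveDX]
      norm_num
      field_simp
      linear_combination hα
    · rw [if_neg (by simp [h])]
      refine hasResidue_zero_of_hasOrdGE (AnalyticAt.hasOrdGE_zero ?_)
      refine AnalyticAt.mul (AnalyticAt.inv
        (((analyticAt_curveX h0).fun_sub analyticAt_const).fun_pow _) (pow_ne_zero _ ?_))
        (analyticAt_curveDX h0)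
      rw [curveX_sub hβ h0]
      exact div_ne_zero (pow_ne_zero 2 (sub_ne_zero.mpr h)) h0
  · rw [if_neg (by omega)]
    obtain ⟨m, hm⟩ := hasOrdGE_curveX_sub_pow_inv hα hβ (a + 1)
    refine hasResidue_zero_of_hasDerivAt (hm.mul (analyticAt_curveDX h0).hasOrdGE_zero)
      (F := fun w => -(a : ℂ)⁻¹ * ((curveX w - 2 * β) ^ a)⁻¹) ?_
    filter_upwards [eventually_punctured_ne hα] with w hw
    have hne := curveX_sub_ne_zero hβ hw.1 hw.2
    have d1 := ((((hasDerivAt_curveX hw.1).sub_const (2 * β)).pow a).inv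
      (pow_ne_zero a hne)).const_mul (-(a : ℂ)⁻¹)
    refine d1.congr_deriv ?_
    have ha' : (a : ℂ) ≠ 0 := by exact_mod_cast ha.ne'
    obtain ⟨c, rfl⟩ : ∃ c, a = c + 1 := ⟨a - 1, by omega⟩
    simp only [Pi.pow_apply, Nat.add_sub_cancel]
    generalize curveX w - 2 * β = X at *
    field_simp
    ring

/-- Partial fractions reduce to a single pole on the x-line, where only the exponent 1 leaves a
residue. It is 2 because x is ramified there. -/
theorem hasResidueSum_pulledBackForm (n : ℕ) : ∀ a b : ℕ, a + b = n + 1 →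
    HasResidueSum (pulledBackForm a b) (if n = 0 then 2 else 0) := by
  have pure : ∀ (β : ℂ), β ^ 2 = 1 → ∀ a : ℕ,
      HasResidueSum (fun w => ((curveX w - 2 * β) ^ (a + 1))⁻¹ * curveDX w)
        (if a = 0 then 2 else 0) := by
    intro β hβ a
    refine ⟨_, _, hasResidue_curveX_sub_pow_inv (by norm_num) hβ a,
      hasResidue_curveX_sub_pow_inv (by norm_num) hβ a, ?_⟩
    have h1 : (1 : ℂ) ≠ -1 := by norm_num
    rcases eq_one_or_eq_neg_one_of_sq_eq_one hβ with rfl | rfl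
    · simp [h1.symm]
    · simp [h1]
  have hl : ∀ a, HasResidueSum (pulledBackForm (a + 1) 0) (if a = 0 then 2 else 0) := fun a =>
    (pure 1 (by norm_num) a).congr fun w _ _ => by simp [pulledBackForm]
  have hr : ∀ b, HasResidueSum (pulledBackForm 0 (b + 1)) (if b = 0 then 2 else 0) := fun b =>
    (pure (-1) (by norm_num) b).congr fun w _ _ => by simp [pulledBackForm]
  induction n with
  | zero =>
    intro a b hab
    rcases a with _ | a
    · obtain rfl : b = 1 := by omega
      exact hr 0
    · obtain ⟨rfl, rfl⟩ : a = 0 ∧ b = 0 := by omega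
      exact hl 0
  | succ n ih =>
    intro a b hab
    rcases a with _ | a
    · obtain rfl : b = n + 2 := by omega
      exact hr (n + 1)
    · rcases b with _ | b
      · obtain rfl : a = n + 1 := by omega
        exact hl (n + 1)
      -- This uses 4 = (x + 2) - (x - 2). The two residue sums from the previous step are equal, so
      -- they cancel even when both are 2.
      · have h := ((ih (a + 1) b (by omega)).const_mul (1 / 4)).add
          ((ih a (b + 1) (by omega)).const_mul (-1 / 4))
        rw [if_neg (Nat.succ_ne_zero n)]
        convert h.congr (g := pulledBackForm (a + 1) (b + 1)) ?_ using 1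
        · ring
        · intro w hw hw2
          have h1 := curveX_sub_two_ne_zero hw hw2
          have h2 := curveX_add_two_ne_zero hw hw2
          simp only [pulledBackForm]
          field_simp
          ring

/-- The bound k + 2 ≤ a + b says that the differential on the x-line is regular at infinity. Powers
of x are removed one at a time by x = (x - 2) + 2 or x = (x + 2) - 2. -/
theorem hasResidueSum_curveX_pow_mul_pulledBackForm (k : ℕ) : ∀ a b : ℕ, k + 2 ≤ a + b →
    HasResidueSum (fun w => curveX w ^ k * pulledBackForm a b w) 0 := by
  induction k with
  | zero =>
    intro a b hab
    have := hasResidueSum_pulledBackForm (a + b - 1) a b (by omega)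
    rw [if_neg (by omega)] at this
    simpa using this
  | succ k ih =>
    intro a b hab
    rcases a with _ | a
    · obtain ⟨b, rfl⟩ : ∃ c, b = c + 1 := ⟨b - 1, by omega⟩
      have h := (ih 0 b (by omega)).add ((ih 0 (b + 1) (by omega)).const_mul (-2))
      convert h.congr (g := fun w => curveX w ^ (k + 1) * pulledBackForm 0 (b + 1) w) ?_ using 1
      · ring
      · intro w hw hw2
        have h2 := curveX_add_two_ne_zero hw hw2
        simp only [pulledBackForm]
        field_simp
        ring
    · have h := (ih a b (by omega)).add ((ih (a + 1) b (by omega)).const_mul 2)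
      convert h.congr (g := fun w => curveX w ^ (k + 1) * pulledBackForm (a + 1) b w) ?_ using 1
      · ring
      · intro w hw hw2
        have h1 := curveX_sub_two_ne_zero hw hw2
        simp only [pulledBackForm]
        field_simp
        ring

theorem poleForm_eq {β w : ℂ} (hβ : β ^ 2 = 1) (hw : w ≠ 0) (j : ℕ) :
    poleForm β j w = w⁻¹ * ((curveX w - 2 * β) ^ (j + 1))⁻¹ := by
  rw [poleForm, curveX_sub hβ hw, div_pow, ← pow_mul, show 2 * (j + 1) = 2 * j + 2 by ring]
  rcases eq_or_ne w β with rfl | h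
  · simp
  · have := sub_ne_zero.mpr h
    field_simp
    ring

/-- Dividing dz²/z² by dx thus gives dx / ((x - 2)(x + 2)), which lives on the x-line. -/
theorem curveDX_sq {w : ℂ} (hw : w ≠ 0) :
    curveDX w ^ 2 = (w ^ 2)⁻¹ * ((curveX w - 2) * (curveX w + 2)) := by
  rw [curveDX, curveX]
  field_simp
  ring

theorem curveDX_ne_zero {w : ℂ} (hw : w ≠ 0) (hw2 : w ^ 2 ≠ 1) : curveDX w ≠ 0 := by
  rw [curveDX]
  intro h
  apply hw2
  field_simp at h
  linear_combination h

/-- The sum of the residues of `x^k q / dx` vanishes for `k ≤ 2`, since this differential has no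
other poles. -/
theorem hasResidueSum_curveX_pow_mul_div {q : ℂ → ℂ} (hq : q ∈ poleSpace * poleSpace) {k : ℕ}
    (hk : k ≤ 2) : HasResidueSum (fun w => curveX w ^ k * (q w / curveDX w)) 0 := by
  have hq' := hq
  unfold poleSpace at hq'
  rw [Submodule.span_mul_span] at hq'
  induction hq' using Submodule.span_induction with
  | mem q h =>
    obtain ⟨_, ⟨β, hβ, i, rfl⟩, _, ⟨γ, hγ, j, rfl⟩, rfl⟩ := h
    have key : ∀ w, w ≠ 0 → w ^ 2 ≠ 1 →
        curveX w ^ k * ((poleForm β i * poleForm γ j) w / curveDX w)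
        = curveX w ^ k * (((curveX w - 2 * β) ^ (i + 1))⁻¹ * ((curveX w - 2 * γ) ^ (j + 1))⁻¹
          * ((curveX w - 2)⁻¹ * (curveX w + 2)⁻¹) * curveDX w) := by
      intro w hw hw2
      have h1 := curveX_sub_two_ne_zero hw hw2
      have h2 := curveX_add_two_ne_zero hw hw2
      have h3 := curveDX_ne_zero hw hw2
      have h4 := curveDX_sq hw
      have h5 : (curveX w - 2)⁻¹ * (curveX w + 2)⁻¹ = (w ^ 2)⁻¹ * (curveDX w ^ 2)⁻¹ := by
        rw [h4]
        field_simp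
      rw [h5, Pi.mul_apply, poleForm_eq hβ hw, poleForm_eq hγ hw]
      field_simp
    -- In all four cases the exponents of x - 2 and x + 2 add up to i + j + 4, which is at least k +
    -- 2.
    rcases eq_one_or_eq_neg_one_of_sq_eq_one hβ with rfl | rfl <;>
      rcases eq_one_or_eq_neg_one_of_sq_eq_one hγ with rfl | rfl
    · refine (hasResidueSum_curveX_pow_mul_pulledBackForm k (i + j + 3) 1 (by omega)).congr
        fun w hw hw2 => ?_
      rw [key w hw hw2, pulledBackForm, mul_one]
      generalize curveX w - 2 = X, curveX w + 2 = Y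
      ring
    · refine (hasResidueSum_curveX_pow_mul_pulledBackForm k (i + 2) (j + 2) (by omega)).congr
        fun w hw hw2 => ?_
      rw [key w hw hw2, pulledBackForm, mul_one, show curveX w - 2 * -1 = curveX w + 2 by ring]
      generalize curveX w - 2 = X, curveX w + 2 = Y
      ring
    · refine (hasResidueSum_curveX_pow_mul_pulledBackForm k (j + 2) (i + 2) (by omega)).congr
        fun w hw hw2 => ?_
      rw [key w hw hw2, pulledBackForm, mul_one, show curveX w - 2 * -1 = curveX w + 2 by ring]
      generalize curveX w - 2 = X, curveX w + 2 = Y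
      ring
    · refine (hasResidueSum_curveX_pow_mul_pulledBackForm k 1 (i + j + 3) (by omega)).congr
        fun w hw hw2 => ?_
      rw [key w hw hw2, pulledBackForm, show curveX w - 2 * -1 = curveX w + 2 by ring]
      generalize curveX w - 2 = X, curveX w + 2 = Y
      ring
  | zero => exact HasResidueSum.zero.congr fun w _ _ => by simp
  | add f g hf hg hf' hg' =>
    rw [← Submodule.span_mul_span] at hf hg
    have h := (hf' hf).add (hg' hg)
    rw [add_zero] at h
    exact h.congr fun w _ _ => by simp only [Pi.add_apply]; ring
  | smul c f hf hf' =>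
    rw [← Submodule.span_mul_span] at hf
    have h := (hf' hf).const_mul c
    rw [mul_zero] at h
    exact h.congr fun w _ _ => by simp only [Pi.smul_apply, smul_eq_mul]; ring

/-- The string equations in terms of residues. -/
theorem hasResidueSum_curveX_pow_mul_mul {y ω q : ℂ → ℂ} (hy : IsRegularAtBranchPoints y)
    (hω : ω ∈ poleSpace) (hq : q ∈ poleSpace * poleSpace)
    (hreg : ∀ α : ℂ, α ^ 2 = 1 → HasOrdGE α 0 (fun w => ω w + kernelDenom y w * q w)) :
    ∃ M : ℕ, ∀ p : ℂ → ℂ, (∀ α : ℂ, α ^ 2 = 1 → HasOrdGE α M (fun w => p w - y w)) →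
      ∀ k ≤ 2, HasResidueSum (fun w => curveX w ^ k * p w * ω w) 0 := by
  obtain ⟨m, hm⟩ := poleSpace_hasOrdGE hω 1
  obtain ⟨n, hn⟩ := poleSpace_hasOrdGE hω (-1)
  -- This order of agreement with y exceeds or equals the pole order of ω at both branch points.
  refine ⟨m.natAbs + n.natAbs, fun p hp k hk => ?_⟩
  have key : ∀ α r : ℂ, α ^ 2 = 1 → (∃ l : ℤ, 0 ≤ ((m.natAbs + n.natAbs : ℕ) : ℤ) + l ∧
      HasOrdGE α l ω) →
      HasResidue (fun w => curveX w ^ k * (q w / curveDX w)) α r →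
      HasResidue (fun w => curveX w ^ k * p w * ω w) α (-(1 / 2) * r) := by
    rintro α r hα ⟨l, hl, hlω⟩ hr
    have h0 := ne_zero_of_sq_eq_one hα
    have hy1 := (hy α hα).1
    have hy2 := analyticAt_comp_one_div hα hy1
    have hX : AnalyticAt ℂ (fun w => curveX w ^ k) α := (analyticAt_curveX h0).fun_pow k
    obtain ⟨t, ht⟩ := poleSpace_mul_hasOrdGE hq α
    -- With D = `kernelDenom y`, p ω = (p - y) ω + y (ω + D q) - (y + ŷ) D q / 2 - (y - ŷ) D q / 2.
    -- After multiplication by x^k, the first two terms are regular, the third is antisymmetric, and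
    -- the last is -x^k q / (2 dx).
    have b1 : HasResidue (fun w => curveX w ^ k * ((p w - y w) * ω w)) α 0 :=
      hasResidue_zero_of_hasOrdGE ((hX.hasOrdGE_zero.mul ((hp α hα).mul hlω)).mono (by omega))
    have b2 : HasResidue (fun w => curveX w ^ k * (y w * (ω w + kernelDenom y w * q w))) α 0 :=
      hasResidue_zero_of_hasOrdGE
        ((hX.hasOrdGE_zero.mul (hy1.hasOrdGE_zero.mul (hreg α hα))).mono (by omega))
    have b3 : HasResidue
        (fun w => curveX w ^ k * (y w + y (1 / w)) * (kernelDenom y w * q w)) α 0 := by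
      refine IsAntisymmAt.hasResidue_zero hα ?_
        ((hX.fun_mul (hy1.fun_add hy2)).hasOrdGE_zero.mul ((kernelDenom_hasOrdGE hy hα).mul ht))
      filter_upwards [isAntisymmAt_kernelDenom_mul y hq hα] with w hw
      rw [hw, one_div_one_div, show curveX (1 / w) = curveX w by
        rw [curveX, curveX, one_div_one_div, add_comm]]
      ring
    have b4 := ((b1.add b2).add (b3.const_mul (-(1 / 2)))).add (hr.const_mul (-(1 / 2)))
    simp only [mul_zero, add_zero, zero_add] at b4
    have hyd : ∀ᶠ w in 𝓝[≠] α, y w - y (1 / w) ≠ 0 :=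
      (hasDerivAt_sub_comp_one_div hα hy1).eventually_ne (mul_ne_zero two_ne_zero (hy α hα).2)
    refine b4.congr ?_
    filter_upwards [eventually_punctured_ne hα, hyd] with w hw hw2
    have h3 := curveDX_ne_zero hw.1 hw.2
    rw [kernelDenom]
    field_simp
    ring
  obtain ⟨r₁, r₂, h1, h2, h3⟩ := hasResidueSum_curveX_pow_mul_div hq hk
  refine ⟨_, _, key 1 r₁ (by norm_num) ⟨m, by omega, hm⟩ h1,
    key (-1) r₂ (by norm_num) ⟨n, by omega, hn⟩ h2, ?_⟩
  linear_combination -(1 / 2) * h3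

/-! ### Quasi-polynomials -/

theorem HasSum.congr_terms {f f' : ℕ → ℂ} {a a' : ℂ} (h : HasSum f a) (hf : ∀ k, f' k = f k)
    (ha : a' = a) : HasSum f' a' := by
  rw [ha, funext hf]
  exact h

theorem IsParityQuasiPolynomial.add {N N' : ℤ → ℂ} (h : IsParityQuasiPolynomial N)
    (h' : IsParityQuasiPolynomial N') : IsParityQuasiPolynomial (fun b => N b + N' b) := by
  obtain ⟨p₀, p₁, hp⟩ := h
  obtain ⟨q₀, q₁, hq⟩ := h'
  refine ⟨p₀ + q₀, p₁ + q₁, fun b => ?_⟩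
  dsimp only
  rw [hp, hq]
  split_ifs <;> simp

theorem IsParityQuasiPolynomial.const_mul {N : ℤ → ℂ} (c : ℂ) (h : IsParityQuasiPolynomial N) :
    IsParityQuasiPolynomial (fun b => c * N b) := by
  obtain ⟨p₀, p₁, hp⟩ := h
  refine ⟨C c * p₀, C c * p₁, fun b => ?_⟩
  dsimp only
  rw [hp]
  split_ifs <;> simp

theorem polynomial_eq_of_eval_natCast_eq {p q : ℂ[X]} {e : ℕ → ℕ} (he : Function.Injective e)
    (h : ∀ n, p.eval (e n : ℂ) = q.eval (e n : ℂ)) : p = q := by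
  refine Polynomial.eq_of_infinite_eval_eq p q (Set.infinite_of_injective_forall_mem
    (f := fun n => (e n : ℂ)) ?_ h)
  exact Nat.cast_injective.comp he

/-- A quasi-polynomial is determined by its values at the positive integers. -/
theorem IsParityQuasiPolynomial.eq_of_forall_pos {N N' : ℤ → ℂ} (h : IsParityQuasiPolynomial N)
    (h' : IsParityQuasiPolynomial N') (heq : ∀ k : ℕ, N (k + 1) = N' (k + 1)) : N = N' := by
  obtain ⟨p₀, p₁, hp⟩ := h
  obtain ⟨q₀, q₁, hq⟩ := h'
  have h0 : p₀ = q₀ := by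
    refine polynomial_eq_of_eval_natCast_eq (e := fun n => 2 * n + 2)
      (fun a b hab => by simpa using hab) fun n => ?_
    have h1 := heq (2 * n + 1)
    have h2 : Even (((2 * n + 1 : ℕ) : ℤ) + 1) := ⟨n + 1, by push_cast; ring⟩
    rw [hp, hq, if_pos h2, if_pos h2] at h1
    convert h1 using 2 <;> push_cast <;> ring
  have h1 : p₁ = q₁ := by
    refine polynomial_eq_of_eval_natCast_eq (e := fun n => 2 * n + 1)
      (fun a b hab => by simpa using hab) fun n => ?_
    have h1 := heq (2 * n)
    have h2 : ¬ Even (((2 * n : ℕ) : ℤ) + 1) := by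
      rw [Int.not_even_iff_odd]
      exact ⟨n, by push_cast; ring⟩
    rw [hp, hq, if_neg h2, if_neg h2] at h1
    convert h1 using 2 <;> push_cast <;> ring
  funext b
  rw [hp, hq, h0, h1]

/-- The Taylor coefficients at 0 fix N at all positive integers, hence each of its two polynomials
at infinitely many points. -/
theorem IsEOQuasiPolynomial.unique {y : ℂ → ℂ} {g : ℕ} {N N' : ℤ → ℂ}
    (h : IsEOQuasiPolynomial y g N) (h' : IsEOQuasiPolynomial y g N') : N = N' := by
  refine h.1.eq_of_forall_pos h'.1 fun k => ?_
  have key : ∀ N : ℤ → ℂ, IsEOQuasiPolynomial y g N → HasFPowerSeriesAt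
      (fun z => eoForm y g 1 (fun _ => z))
      (FormalMultilinearSeries.ofScalars ℂ fun k : ℕ => ((k : ℂ) + 1) * N ((k : ℤ) + 1)) 0 := by
    intro N hN
    rw [hasFPowerSeriesAt_iff]
    filter_upwards [hN.2] with z hz
    refine hz.congr_terms (fun k => ?_) (by rw [zero_add])
    rw [FormalMultilinearSeries.coeff_ofScalars, smul_eq_mul, mul_comm]
  have h1 := (key N h).eq_formalMultilinearSeries (key N' h')
  have h2 := congrArg (fun p => p.coeff k) h1
  simp only [FormalMultilinearSeries.coeff_ofScalars] at h2
  exact mul_left_cancel₀ (by exact_mod_cast k.succ_ne_zero) h2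

/-- The polynomial `(b - j) ⋯ (b - 1) (b + 1) ⋯ (b + j) / (2j + 1)!`. -/
noncomputable def polePoly (j : ℕ) : ℂ[X] :=
  C ((2 * j + 1).factorial : ℂ)⁻¹ * ∏ i ∈ (Finset.range (2 * j + 1)).erase j, (X + C ((j : ℂ) - i))

theorem mul_eval_polePoly (j : ℕ) (b : ℂ) : b * (polePoly j).eval b
    = (∏ i ∈ Finset.range (2 * j + 1), (b + j - i)) / (2 * j + 1).factorial := by
  rw [← Finset.mul_prod_erase _ _ (Finset.mem_range.mpr (by omega : j < 2 * j + 1)), polePoly,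
    eval_mul, eval_C, eval_prod]
  have : ∀ i ∈ (Finset.range (2 * j + 1)).erase j,
      (X + C ((j : ℂ) - i)).eval b = b + j - i := fun i _ => by simp; ring
  rw [Finset.prod_congr rfl this]
  ring

/-- This sign is the source of the dependence on parity: the pole at -1 contributes an alternating
factor. -/
theorem zpow_of_sq_eq_one {β : ℂ} (hβ : β ^ 2 = 1) (b : ℤ) (j : ℕ) :
    β ^ (b - j - 1) = if Even b then β ^ (j + 1) else β ^ j := by
  have h0 := ne_zero_of_sq_eq_one hβ
  have h1 : β ^ (-(j : ℤ)) = β ^ j := by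
    rw [zpow_neg, zpow_natCast, ← inv_pow, ← one_div, one_div_of_sq_eq_one hβ]
  have h2 : ∀ m : ℤ, β ^ (2 * m) = 1 := fun m => by
    rw [zpow_mul, zpow_ofNat, hβ, one_zpow]
  split_ifs with h
  · obtain ⟨m, rfl⟩ := h
    rw [show m + m - j - 1 = 2 * (m - 1) + (-(j : ℤ) + 1) by ring, zpow_add₀ h0, h2,
      zpow_add₀ h0, h1, zpow_one, one_mul, pow_succ]
  · obtain ⟨m, rfl⟩ := Int.not_even_iff_odd.mp h
    rw [show 2 * m + 1 - j - 1 = 2 * m + -(j : ℤ) by ring, zpow_add₀ h0, h2, h1, one_mul]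

/-- As β² = 1, (z - β)² = (1 - βz)², so the form is z^j (1 - βz)^{-2j-2}. The binomial series has
the coefficients C(b + j, 2j + 1) = b · `polePoly j`(b), up to powers of β. -/
theorem hasSum_poleForm {β : ℂ} (hβ : β ^ 2 = 1) (j : ℕ) {z : ℂ} (hz : ‖z‖ < 1) :
    HasSum (fun k : ℕ => ((k : ℂ) + 1) * (β ^ ((k : ℤ) + 1 - j - 1) *
      (polePoly j).eval ((k : ℂ) + 1)) * z ^ k) (poleForm β j z) := by
  have h0 := ne_zero_of_sq_eq_one hβ
  have hβn : ‖β‖ = 1 := by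
    have := congrArg norm hβ
    rw [norm_pow, norm_one] at this
    exact (pow_eq_one_iff_of_nonneg (norm_nonneg _) two_ne_zero).mp this
  have hcoef : ∀ k : ℕ, ((k : ℂ) + 1) * (polePoly j).eval ((k : ℂ) + 1)
      = ((k + 1 + j).choose (2 * j + 1) : ℂ) := by
    intro k
    have h1 : ∏ i ∈ Finset.range (2 * j + 1), ((k : ℂ) + 1 + j - i)
        = ((k + 1 + j).descFactorial (2 * j + 1) : ℂ) := by
      rw [← descPochhammer_eval_eq_descFactorial, descPochhammer_eval_eq_prod_range]
      push_cast
      rfl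
    rw [mul_eval_polePoly, h1, Nat.descFactorial_eq_factorial_mul_choose]
    have := Nat.factorial_ne_zero (2 * j + 1)
    push_cast
    field_simp
  rw [← hasSum_nat_add_iff' j]
  -- The quasi-polynomial vanishes at b = 1, …, j, which matches the zero of order j at the origin.
  have hs : ∑ k ∈ Finset.range j, ((k : ℂ) + 1) * (β ^ ((k : ℤ) + 1 - j - 1) *
      (polePoly j).eval ((k : ℂ) + 1)) * z ^ k = 0 := by
    refine Finset.sum_eq_zero fun k hk => ?_
    have hk' := Finset.mem_range.mp hk
    rw [mul_left_comm, hcoef, Nat.choose_eq_zero_of_lt (by omega)]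
    simp
  rw [hs, sub_zero]
  have hr : ‖β * z‖ < 1 := by rwa [norm_mul, hβn, one_mul]
  have h2 := (hasSum_choose_mul_geometric_of_norm_lt_one (2 * j + 1) hr).mul_left (z ^ j)
  refine h2.congr_terms (fun n => ?_) ?_
  · rw [mul_left_comm, hcoef,
      show ((n + j : ℕ) : ℤ) + 1 - j - 1 = n by push_cast; ring, zpow_natCast,
      show n + j + 1 + j = n + (2 * j + 1) by ring]
    ring
  · have h3 : (1 - β * z) ^ (2 * j + 1 + 1) = (z - β) ^ (2 * j + 2) := by
      have : (1 - β * z) ^ 2 = (z - β) ^ 2 := by linear_combination (z ^ 2 - 1) * hβ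
      rw [show 2 * j + 1 + 1 = 2 * (j + 1) by ring, pow_mul, this, ← pow_mul]
    rw [poleForm, h3]
    ring

/-- Cauchy's formula takes the derivative of order 2j + 1 of w^{b+j}. The resulting falling
factorial is the expression for the Taylor coefficients at 0, now for every integer b. -/
theorem hasResidue_zpow_mul_poleForm {β : ℂ} (hβ : β ^ 2 = 1) (j : ℕ) (b : ℤ) :
    HasResidue (fun w => w ^ b * poleForm β j w) β
      (b * (β ^ (b - j - 1) * (polePoly j).eval (b : ℂ))) := by
  have h0 := ne_zero_of_sq_eq_one hβ
  have ha : AnalyticAt ℂ (fun w : ℂ => w ^ (b + j)) β :=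
    analyticAt_id.zpow h0
  have h := ha.hasResidue_zpow_mul (2 * j + 1)
  have e : iteratedDeriv (2 * j + 1) (fun w : ℂ => w ^ (b + j)) β / (2 * j + 1).factorial
      = b * (β ^ (b - j - 1) * (polePoly j).eval (b : ℂ)) := by
    rw [mul_left_comm, mul_eval_polePoly, iteratedDeriv_eq_iterate, iter_deriv_zpow,
      show b + j - ((2 * j + 1 : ℕ) : ℤ) = b - j - 1 by push_cast; ring]
    push_cast
    ring
  rw [e] at h
  refine h.congr ?_
  filter_upwards [eventually_punctured_ne hβ] with w hw
  rw [poleForm, zpow_add₀ hw.1, zpow_neg, show ((2 * j + 1 : ℕ) : ℤ) + 1 = ((2 * j + 2 : ℕ) : ℤ) by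
    push_cast; ring, zpow_natCast, zpow_natCast]
  ring

/-- The coefficients of the expansion at `0` of an antisymmetric form are given by a
quasi-polynomial, which is computed by residues at the branch points for all integers `b`. -/
theorem poleSpace_exists_quasiPolynomial {ω : ℂ → ℂ} (hω : ω ∈ poleSpace) :
    ∃ N : ℤ → ℂ, IsParityQuasiPolynomial N ∧
      (∀ z : ℂ, ‖z‖ < 1 → HasSum (fun k : ℕ => ((k : ℂ) + 1) * N ((k : ℤ) + 1) * z ^ k) (ω z)) ∧
      ∀ b : ℤ, HasResidueSum (fun w => w ^ b * ω w) (b * N b) := by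
  induction hω using Submodule.span_induction with
  | mem f h =>
    obtain ⟨β, hβ, j, rfl⟩ := h
    refine ⟨fun b => β ^ (b - j - 1) * (polePoly j).eval (b : ℂ),
      ⟨C (β ^ (j + 1)) * polePoly j, C (β ^ j) * polePoly j, fun b => ?_⟩, fun z hz => ?_,
      fun b => ?_⟩
    · dsimp only
      rw [zpow_of_sq_eq_one hβ]
      split_ifs <;> simp
    · simpa using hasSum_poleForm hβ j hz
    · have h1 := hasResidue_zpow_mul_poleForm hβ j b
      have h2 : ∀ α : ℂ, α ^ 2 = 1 → α ≠ β →
          HasResidue (fun w => w ^ b * poleForm β j w) α 0 := fun α hα hne => by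
        have h0 := ne_zero_of_sq_eq_one hα
        have ha : AnalyticAt ℂ (fun w : ℂ => w ^ b) α := analyticAt_id.zpow h0
        exact hasResidue_zero_of_hasOrdGE (ha.mul (poleForm_analyticAt hne j)).hasOrdGE_zero
      rcases eq_one_or_eq_neg_one_of_sq_eq_one hβ with rfl | rfl
      · exact ⟨_, 0, h1, h2 (-1) (by norm_num) (by norm_num), by rw [add_zero]⟩
      · exact ⟨0, _, h2 1 (by norm_num) (by norm_num), h1, by rw [zero_add]⟩
  | zero =>
    refine ⟨0, ⟨0, 0, fun b => by simp⟩, fun z _ => by simp [hasSum_zero], fun b => ?_⟩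
    simpa using HasResidueSum.zero
  | add f g _ _ hf hg =>
    obtain ⟨N, h1, h2, h3⟩ := hf
    obtain ⟨N', h1', h2', h3'⟩ := hg
    refine ⟨_, h1.add h1', fun z hz => ?_, fun b => ?_⟩
    · exact ((h2 z hz).add (h2' z hz)).congr_terms (fun k => by ring) rfl
    · convert (h3 b).add (h3' b) using 1
      · funext w
        simp only [Pi.add_apply]
        ring
      · ring
  | smul c f _ hf =>
    obtain ⟨N, h1, h2, h3⟩ := hf
    refine ⟨_, h1.const_mul c, fun z hz => ?_, fun b => ?_⟩
    · exact ((h2 z hz).mul_left c).congr_terms (fun k => by ring) rfl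
    · convert (h3 b).const_mul c using 1
      · funext w
        simp only [Pi.smul_apply, smul_eq_mul]
        ring
      · ring

/-- `p(𝒟)` acting on the coefficients `b N(b)` of `ω` is the multiplication of `ω` by `p`. -/
theorem hasResidueSum_shiftApply {ω : ℂ → ℂ} {N : ℤ → ℂ}
    (h : ∀ b : ℤ, HasResidueSum (fun w => w ^ b * ω w) (b * N b)) (p : ℂ[X]) (a : ℤ) :
    HasResidueSum (fun w => w ^ a * p.eval w * ω w) (shiftApply p (fun m => (m : ℂ) * N m) a) := by
  have h1 := HasResidueSum.sum (S := p.support) fun i _ => (h (a + i)).const_mul (p.coeff i)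
  refine h1.congr fun w hw _ => ?_
  rw [eval_eq_sum, Polynomial.sum, Finset.mul_sum, Finset.sum_mul]
  refine Finset.sum_congr rfl fun i _ => ?_
  rw [zpow_add₀ hw, zpow_natCast]
  ring

/-! ### The string equations -/

/-- Existence and uniqueness of `N^g_1`, its values as sums of residues, and the string equations
as statements on residues. -/
theorem exists_quasiPolynomial_of_isRegularAtBranchPoints {y : ℂ → ℂ}
    (hy : IsRegularAtBranchPoints y) {g : ℕ} (hg : 1 < g) :
    ∃ (N : ℤ → ℂ) (ω : ℂ → ℂ), IsEOQuasiPolynomial y g N ∧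
      (∀ N', IsEOQuasiPolynomial y g N' → N' = N) ∧
      (∀ b : ℤ, HasResidueSum (fun w => w ^ b * ω w) (b * N b)) ∧
      ∃ M : ℕ, ∀ p : ℂ → ℂ, (∀ α : ℂ, α ^ 2 = 1 → HasOrdGE α M (fun w => p w - y w)) →
        ∀ k ≤ 2, HasResidueSum (fun w => curveX w ^ k * p w * ω w) 0 := by
  obtain ⟨ω, hω, q, hq, he, hreg⟩ := exists_onePointForm hy hg
  obtain ⟨N, hN, hsum, hres⟩ := poleSpace_exists_quasiPolynomial hω
  have hEO : IsEOQuasiPolynomial y g N := by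
    refine ⟨hN, ?_⟩
    filter_upwards [Metric.ball_mem_nhds (0 : ℂ) one_pos] with z hz
    rw [mem_ball_zero_iff] at hz
    rw [he z fun h => ?_]
    · exact hsum z hz
    · have := congrArg norm h
      rw [norm_pow, norm_one, pow_eq_one_iff_of_nonneg (norm_nonneg _) two_ne_zero] at this
      exact hz.ne this
  exact ⟨N, ω, hEO, fun N' hN' => hN'.unique hEO, hres,
    hasResidueSum_curveX_pow_mul_mul hy hω hq hreg⟩

theorem isRegularAtBranchPoints_pow {m : ℕ} (hm : 1 ≤ m) :
    IsRegularAtBranchPoints (fun z => z ^ m / (m : ℂ)) := by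
  intro α hα
  have hm' : (m : ℂ) ≠ 0 := by exact_mod_cast (by omega : m ≠ 0)
  refine ⟨by fun_prop (disch := assumption), ?_⟩
  rw [deriv_div_const, deriv_pow_field]
  have := ne_zero_of_sq_eq_one hα
  positivity

theorem partialSum_sub_hasOrdGE {y : ℂ → ℂ} {α : ℂ} (hα : α ^ 2 = 1) (hy : AnalyticAt ℂ y α)
    {M N : ℕ} (h : M ≤ N) : HasOrdGE α M (fun w => (partialSum y N).eval w - y w) := by
  have h1 : AnalyticAt ℂ (fun w => (partialSum y N).eval w) α :=
    (partialSum y N).differentiable.analyticAt α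
  have hmem : α ∈ ({1, -1} : Finset ℂ) := by
    simpa using eq_one_or_eq_neg_one_of_sq_eq_one hα
  refine HasOrdGE.of_iteratedDeriv_eq_zero (h1.fun_sub hy) fun i hi => ?_
  rw [iteratedDeriv_fun_sub h1.contDiffAt hy.contDiffAt, iteratedDeriv_polynomial_eval]
  exact sub_eq_zero.mpr (partialSum_spec y (by omega) hmem)

theorem mainTheorem6 (g : ℕ) (hg : 1 < g) :
    (∀ m : ℕ, 1 ≤ m →
      (∃! N : ℤ → ℂ, IsEOQuasiPolynomial (fun z => z ^ m / (m : ℂ)) g N) ∧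
      ∀ N : ℤ → ℂ, IsEOQuasiPolynomial (fun z => z ^ m / (m : ℂ)) g N →
        N m = 0 ∧
        ((m : ℂ) + 1) * N ((m : ℤ) + 1) + ((m : ℂ) - 1) * N ((m : ℤ) - 1) = 0 ∧
        ((m : ℂ) - 2) * N ((m : ℤ) - 2) - 2 * (m : ℂ) * N m
          + ((m : ℂ) + 2) * N ((m : ℤ) + 2) = 0) ∧
    (∀ y : ℂ → ℂ, AnalyticAt ℂ y 1 → AnalyticAt ℂ y (-1) → deriv y 1 ≠ 0 → deriv y (-1) ≠ 0 →
      (∃! N : ℤ → ℂ, IsEOQuasiPolynomial y g N) ∧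
      ∀ N : ℤ → ℂ, IsEOQuasiPolynomial y g N →
        ShiftValueEq Polynomial.X y (fun m => (m : ℂ) * N m) (-1) 0 ∧
        ShiftValueEq (1 + Polynomial.X ^ 2) y (fun m => (m : ℂ) * N m) (-1) 0 ∧
        ShiftValueEq ((1 - Polynomial.X ^ 2) ^ 2) y (fun m => (m : ℂ) * N m) (-2) 0) := by
  constructor
  · intro m hm
    have hm' : (m : ℂ) ≠ 0 := by exact_mod_cast (by omega : m ≠ 0)
    obtain ⟨N, ω, hN, huniq, hres, M, hM⟩ :=
      exists_quasiPolynomial_of_isRegularAtBranchPoints (isRegularAtBranchPoints_pow hm) hg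
    refine ⟨⟨N, hN, huniq⟩, fun N' hN' => ?_⟩
    obtain rfl := huniq N' hN'
    -- Here y is itself a Laurent polynomial on the curve, so it serves as its own approximation.
    have hz := hM (fun z => z ^ m / (m : ℂ))
      fun α _ => HasOrdGE.zero.congr (Eventually.of_forall fun w => by simp)
    have e0 := ((hres m).const_mul (1 / m)).congr
      (g := fun w => curveX w ^ 0 * (w ^ m / (m : ℂ)) * ω w) fun w hw _ => by
        rw [zpow_natCast, pow_zero]
        ring
    have e1 := (((hres (m + 1)).add (hres (m - 1))).const_mul (1 / m)).congr
      (g := fun w => curveX w ^ 1 * (w ^ m / (m : ℂ)) * ω w) fun w hw _ => by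
        rw [zpow_add_one₀ hw, zpow_sub_one₀ hw, zpow_natCast, curveX]
        ring
    have e2 := (((hres (m - 2)).add (((hres m).const_mul 2).add (hres (m + 2)))).const_mul
      (1 / m)).congr (g := fun w => curveX w ^ 2 * (w ^ m / (m : ℂ)) * ω w) fun w hw _ => by
        rw [zpow_add₀ hw, zpow_sub₀ hw, zpow_natCast, zpow_ofNat, curveX]
        field_simp
        ring
    have v0 := e0.unique (hz 0 (by norm_num))
    have v1 := e1.unique (hz 1 (by norm_num))
    have v2 := e2.unique (hz 2 (by norm_num))
    push_cast at v0 v1 v2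
    field_simp at v0 v1 v2
    have v0' : N' m = 0 := by simpa using v0
    refine ⟨v0', by linear_combination v1, ?_⟩
    -- Multiplication by x² gives + 2m N(m) in place of - 2m N(m); the sign is immaterial because
    -- N(m) = 0.
    rw [v0'] at v2 ⊢
    linear_combination v2
  · intro y hy1 hy2 hd1 hd2
    have hy : IsRegularAtBranchPoints y := by
      intro α hα
      rcases eq_one_or_eq_neg_one_of_sq_eq_one hα with rfl | rfl
      exacts [⟨hy1, hd1⟩, ⟨hy2, hd2⟩]
    obtain ⟨N, ω, hN, huniq, hres, M, hM⟩ :=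
      exists_quasiPolynomial_of_isRegularAtBranchPoints hy hg
    refine ⟨⟨N, hN, huniq⟩, fun N' hN' => ?_⟩
    obtain rfl := huniq N' hN'
    have hz : ∀ n ≥ M, ∀ k ≤ 2,
        HasResidueSum (fun w => curveX w ^ k * (partialSum y n).eval w * ω w) 0 :=
      fun n hn => hM _ fun α hα => partialSum_sub_hasOrdGE hα (hy α hα).1 hn
    refine ⟨?_, ?_, ?_⟩ <;> filter_upwards [eventually_ge_atTop M] with n hn
    · refine (hasResidueSum_shiftApply hres _ (-1)).unique
        ((hz n hn 0 (by norm_num)).congr fun w hw _ => ?_)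
      rw [eval_mul, eval_X, zpow_neg_one]
      field_simp
    · refine (hasResidueSum_shiftApply hres _ (-1)).unique
        ((hz n hn 1 (by norm_num)).congr fun w hw _ => ?_)
      rw [eval_mul, zpow_neg_one, curveX]
      simp only [eval_add, eval_one, eval_pow, eval_X]
      field_simp
      ring
    -- The combination comes from z⁻² (1 - z²)² = (z - 1/z)² = x² - 4.
    · have h := (hz n hn 2 (by norm_num)).add ((hz n hn 0 (by norm_num)).const_mul (-4))
      rw [mul_zero, add_zero] at h
      refine (hasResidueSum_shiftApply hres _ (-2)).unique (h.congr fun w hw _ => ?_)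
      rw [eval_mul, zpow_neg, zpow_ofNat, curveX]
      simp only [eval_sub, eval_one, eval_pow, eval_X]
      field_simp
      ring
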